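/- For a natural number $k$, a group $G$ is called $[k]$-solvable if there are subgroups $1=G_0\triangleleft G_1\triangleleft\dots\triangleleft G_m=G$ such that each factor $G_i/G_{i-1}$ is either abelian or admits a faithful action on a set with at most $k$ elements. For a prime $n$ let $C_n=\{x\mapsto x+b\}$ and $D_n=\{x\mapsto\pm x+b\}$ be the groups of permutations of $F_n=\mathbb Z/n\mathbb Z$. Permutation groups are identified when they differ only by a relabelling of the elements on which they act. Let $G$ be a group of permutations of a set of $n$ elements which is one of the following (Müller's list of the monodromy groups of primitive polynomials): (a) $G=S_n$; (b) $n$ is odd and $G=A_n$; (c) $n$ is prime and $C_n\subseteq G\subseteq D_n$, acting on $F_n$; (d) $n=11$ and $G=PSL_2(11)$ acting on the $11$ cosets of one of its subgroups of index $11$; (e) $G=PGL_d(p)$ acting naturally on the points or on the hyperplanes of the projective space $P(F_p^d)$, where $(p,d)$ is one of $(5,2),(7,2),(2,3),(3,3),(2,4),(2,5)$ (so that $n=6,8,7,13,15,31$ respectively); (f) $G=P\Gamma L_d(q)$ acting naturally on the points or on the hyperplanes of $P(F_q^d)$, where $(q,d)$ is one of $(8,2),(9,2),(4,3)$ (so that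 $n=9,10,21$ respectively); (g) $n=11$ and $G$ is the Mathieu group $M_{11}$ in its natural action on $11$ elements; (h) $n=23$ and $G$ is the Mathieu group $M_{23}$ in its natural action on $23$ elements. Then, for every natural number $k$, the group $G$ is $[k]$-solvable if and only if at least one of the following holds: 1. $G=S_n$ with $n\le 4$, or $n$ is prime and $C_n\subseteq G\subseteq D_n$ (with $k$ arbitrary); 2. $k\ge n$ and $G$ is one of: $S_n$; $A_n$ with $n\ge5$ odd; $PSL_2(11)$ or $M_{11}$ ($n=11$); $M_{23}$ ($n=23$); $PGL_3(2)$ ($n=7$); $PGL_3(3)$ ($n=13$); $PGL_5(2)$ ($n=31$); $P\Gamma L_3(4)$ ($n=21$); $P\Gamma L_2(8)$ ($n=9$); 3. $G=PGL_2(5)$ and $k\ge5$; 4. $G=P\Gamma L_2(9)$ and $k\ge6$; 5. $G=PGL_2(7)$ and $k\ge7$; 6. $G=PGL_4(2)$ and $k\ge8$. Here every group in 1–6 is taken with its permutation action from the list (a)–(h). -/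

import Mathlib

open scoped MatrixGroups LinearAlgebra.Projectivization

/-- `G` is `[k]`-solvable: there is a finite chain of subgroups `1 = H 0 ≤ H 1 ≤ … ≤ H m = G`,
each normal in the next one, such that every factor `H (i + 1) / H i` is abelian or acts
faithfully on a set with at most `k` elements. -/
def IsKSolvable (k : ℕ) (G : Type*) [Group G] : Prop :=
  ∃ (m : ℕ) (H : ℕ → Subgroup G), H 0 = ⊥ ∧ H m = ⊤ ∧
    ∀ i < m, H i ≤ H (i + 1) ∧
      ∃ _ : ((H i).subgroupOf (H (i + 1))).Normal,
        (∀ a b : H (i + 1) ⧸ (H i).subgroupOf (H (i + 1)), a * b = b * a) ∨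
        ∃ (S : Type) (_ : Fintype S)
          (_ : MulAction (H (i + 1) ⧸ (H i).subgroupOf (H (i + 1))) S),
          FaithfulSMul (H (i + 1) ⧸ (H i).subgroupOf (H (i + 1))) S ∧ Fintype.card S ≤ k

/-- The permutation groups `G` on `X` and `H` on `Y` are the same up to a relabelling of the
elements on which they act. -/
def PermIso {X Y : Type*} (G : Subgroup (Equiv.Perm X)) (H : Subgroup (Equiv.Perm Y)) : Prop :=
  ∃ e : X ≃ Y, ∀ σ : Equiv.Perm X, σ ∈ G ↔ e.permCongr σ ∈ H

/-- The group `C_n` of all shifts `x ↦ x + b` of `ℤ/nℤ`. -/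
def shiftGroup (n : ℕ) : Subgroup (Equiv.Perm (ZMod n)) where
  carrier := {σ | ∃ b, ∀ x, σ x = x + b}
  one_mem' := ⟨0, fun x => by simp⟩
  mul_mem' := by
    rintro σ τ ⟨b, hb⟩ ⟨c, hc⟩
    exact ⟨c + b, fun x => by rw [Equiv.Perm.mul_apply, hc, hb]; ring⟩
  inv_mem' := by
    rintro σ ⟨b, hb⟩
    exact ⟨-b, fun x => by rw [Equiv.Perm.inv_eq_iff_eq, hb]; ring⟩

/-- The group `D_n` of all maps `x ↦ ± x + b` of `ℤ/nℤ`. -/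
def plusMinusGroup (n : ℕ) : Subgroup (Equiv.Perm (ZMod n)) where
  carrier := {σ | ∃ b, (∀ x, σ x = x + b) ∨ (∀ x, σ x = -x + b)}
  one_mem' := ⟨0, Or.inl fun x => by simp⟩
  mul_mem' := by
    rintro σ τ ⟨b, hb | hb⟩ ⟨c, hc | hc⟩
    · exact ⟨c + b, Or.inl fun x => by rw [Equiv.Perm.mul_apply, hc, hb]; ring⟩
    · exact ⟨c + b, Or.inr fun x => by rw [Equiv.Perm.mul_apply, hc, hb]; ring⟩
    · exact ⟨-c + b, Or.inr fun x => by rw [Equiv.Perm.mul_apply, hc, hb]; ring⟩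
    · exact ⟨-c + b, Or.inl fun x => by rw [Equiv.Perm.mul_apply, hc, hb]; ring⟩
  inv_mem' := by
    rintro σ ⟨b, hb | hb⟩
    · exact ⟨-b, Or.inl fun x => by rw [Equiv.Perm.inv_eq_iff_eq, hb]; ring⟩
    · exact ⟨b, Or.inr fun x => by rw [Equiv.Perm.inv_eq_iff_eq, hb]; ring⟩

/-- `G` acts on its `n` elements as a group between `C_n` and `D_n` acts on `ℤ/nℤ`. -/
def IsBetweenCyclicAndDihedral {X : Type*} (n : ℕ) (G : Subgroup (Equiv.Perm X)) : Prop :=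
  ∃ H : Subgroup (Equiv.Perm (ZMod n)), shiftGroup n ≤ H ∧ H ≤ plusMinusGroup n ∧ PermIso G H

/-- `G` is `PSL_2(11)` acting on the cosets of one of its subgroups of index `11`. -/
def IsPSLTwoEleven {X : Type*} (G : Subgroup (Equiv.Perm X)) : Prop :=
  ∃ H : Subgroup PSL(2, ZMod 11), H.index = 11 ∧
    PermIso G (MulAction.toPermHom PSL(2, ZMod 11) (PSL(2, ZMod 11) ⧸ H)).range

/-- The hyperplanes of the projective space of `V`, that is, the maximal proper subspaces
of `V`. -/
def Hyperplane (K V : Type*) [Field K] [AddCommGroup V] [Module K V] : Type _ :=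
  {W : Submodule K V // IsCoatom W}

/-- The permutations of the hyperplanes of `P(K^d)` that are induced by elements of `PGL_d(K)`,
that is, by linear automorphisms `f` of `K^d`: the hyperplane `W` is sent to `f(W)`. -/
def pglHyperplanes (d : ℕ) (K : Type*) [Field K] :
    Subgroup (Equiv.Perm (Hyperplane K (Fin d → K))) where
  carrier := {σ | ∃ f : (Fin d → K) ≃ₗ[K] (Fin d → K), ∀ W v, f v ∈ (σ W).1 ↔ v ∈ W.1}
  one_mem' := ⟨LinearEquiv.refl K _, fun W v => by simp⟩
  mul_mem' := by
    rintro σ τ ⟨f, hf⟩ ⟨g, hg⟩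
    exact ⟨g.trans f, fun W v => by
      rw [Equiv.Perm.mul_apply, LinearEquiv.trans_apply, hf, hg]⟩
  inv_mem' := by
    rintro σ ⟨f, hf⟩
    exact ⟨f.symm, fun W v => by
      rw [← hf, LinearEquiv.apply_symm_apply, ← Equiv.Perm.mul_apply, mul_inv_cancel,
        Equiv.Perm.one_apply]⟩

/-- The group `PΓL_d(K)` as a permutation group of the points of `P(K^d)`: the permutations
induced by the semilinear automorphisms `f` of `K^d`, that is, by the additive automorphisms
with `f (c v) = τ(c) f(v)` for a field automorphism `τ` of `K`. -/
def pGammaLPoints (d : ℕ) (K : Type*) [Field K] : Subgroup (Equiv.Perm (ℙ K (Fin d → K))) where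
  carrier := {σ | ∃ (τ : K ≃+* K) (f : (Fin d → K) ≃+ (Fin d → K)),
    (∀ (c : K) v, f (c • v) = τ c • f v) ∧
    ∀ v (hv : v ≠ 0), σ (.mk K v hv) = .mk K (f v) (f.map_ne_zero_iff.2 hv)}
  one_mem' := ⟨RingEquiv.refl K, AddEquiv.refl _, fun c v => rfl, fun v hv => rfl⟩
  mul_mem' := by
    rintro σ τ ⟨s, f, hf, hf'⟩ ⟨t, g, hg, hg'⟩
    refine ⟨t.trans s, g.trans f, fun c v => ?_, fun v hv => ?_⟩
    · simp [hf, hg]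
    · rw [Equiv.Perm.mul_apply, hg', hf']; rfl
  inv_mem' := by
    rintro σ ⟨s, f, hf, hf'⟩
    refine ⟨s.symm, f.symm, fun c v => ?_, fun v hv => ?_⟩
    · rw [AddEquiv.symm_apply_eq, hf]; simp
    · rw [Equiv.Perm.inv_eq_iff_eq, hf']; simp

/-- The group `PΓL_d(K)` as a permutation group of the hyperplanes of `P(K^d)`. -/
def pGammaLHyperplanes (d : ℕ) (K : Type*) [Field K] :
    Subgroup (Equiv.Perm (Hyperplane K (Fin d → K))) where
  carrier := {σ | ∃ (τ : K ≃+* K) (f : (Fin d → K) ≃+ (Fin d → K)),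
    (∀ (c : K) v, f (c • v) = τ c • f v) ∧ ∀ W v, f v ∈ (σ W).1 ↔ v ∈ W.1}
  one_mem' := ⟨RingEquiv.refl K, AddEquiv.refl _, fun c v => rfl, fun W v => by simp⟩
  mul_mem' := by
    rintro σ τ ⟨s, f, hf, hf'⟩ ⟨t, g, hg, hg'⟩
    refine ⟨t.trans s, g.trans f, fun c v => ?_, fun W v => ?_⟩
    · simp [hf, hg]
    · rw [Equiv.Perm.mul_apply, AddEquiv.trans_apply, hf', hg']
  inv_mem' := by
    rintro σ ⟨s, f, hf, hf'⟩
    refine ⟨s.symm, f.symm, fun c v => ?_, fun W v => ?_⟩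
    · rw [AddEquiv.symm_apply_eq, hf]; simp
    · rw [← hf', AddEquiv.apply_symm_apply, ← Equiv.Perm.mul_apply, mul_inv_cancel,
        Equiv.Perm.one_apply]

/-- `G` is `PGL_d(K)` acting naturally on the points or on the hyperplanes of `P(K^d)`. -/
def IsPGL {X : Type*} (d : ℕ) (K : Type*) [Field K] (G : Subgroup (Equiv.Perm X)) : Prop :=
  PermIso G (MulAction.toPermHom PGL(d, K) (ℙ K (Fin d → K))).range ∨
  PermIso G (pglHyperplanes d K)

/-- `G` is `PΓL_d(K)` acting naturally on the points or on the hyperplanes of `P(K^d)`. -/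
def IsPGammaL {X : Type*} (d : ℕ) (K : Type*) [Field K] (G : Subgroup (Equiv.Perm X)) : Prop :=
  PermIso G (pGammaLPoints d K) ∨ PermIso G (pGammaLHyperplanes d K)

/-- The Mathieu group `M_11` in its natural action on `11` elements, through its standard
generators `(1,2,…,11)` and `(3,7,11,8)(4,10,5,6)`; the elements are numbered from `0` here. -/
def mathieuEleven : Subgroup (Equiv.Perm (Fin 11)) :=
  Subgroup.closure
    {finRotate 11, List.formPerm [2, 6, 10, 7] * List.formPerm [3, 9, 4, 5]}

/-- The Mathieu group `M_23` in its natural action on `23` elements, through its standard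
generators `(1,2,…,23)` and
`(3,17,10,7,9)(4,13,14,19,5)(8,18,11,12,23)(15,20,22,21,16)`; the elements are numbered
from `0` here. -/
def mathieuTwentyThree : Subgroup (Equiv.Perm (Fin 23)) :=
  Subgroup.closure
    {finRotate 23,
      List.formPerm [2, 16, 9, 6, 8] * List.formPerm [3, 12, 13, 18, 4] *
        List.formPerm [7, 17, 10, 11, 22] * List.formPerm [14, 19, 21, 20, 15]}

instance factPrimeFive : Fact (Nat.Prime 5) := ⟨by norm_num⟩

instance factPrimeSeven : Fact (Nat.Prime 7) := ⟨by norm_num⟩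

/-- The permutation groups `G` of `n = |X|` elements on Müller's list of the monodromy groups of
primitive polynomials. -/
def IsOnMullerList {X : Type*} [Fintype X] [DecidableEq X] (G : Subgroup (Equiv.Perm X)) : Prop :=
  G = ⊤ ∨
  (Odd (Fintype.card X) ∧ G = alternatingGroup X) ∨
  ((Fintype.card X).Prime ∧ IsBetweenCyclicAndDihedral (Fintype.card X) G) ∨
  IsPSLTwoEleven G ∨
  (IsPGL 2 (ZMod 5) G ∨ IsPGL 2 (ZMod 7) G ∨ IsPGL 3 (ZMod 2) G ∨ IsPGL 3 (ZMod 3) G ∨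
    IsPGL 4 (ZMod 2) G ∨ IsPGL 5 (ZMod 2) G) ∨
  (IsPGammaL 2 (GaloisField 2 3) G ∨ IsPGammaL 2 (GaloisField 3 2) G ∨
    IsPGammaL 3 (GaloisField 2 2) G) ∨
  PermIso G mathieuEleven ∨
  PermIso G mathieuTwentyThree

/-!
A permutation group of degree at most `k` is `[k]`-solvable, and so is every solvable group. Apart
from the solvable groups on the list, each group `G` on it has a single nonabelian composition
factor, and `G` is `[k]`-solvable exactly when `k` is at least the minimal degree of a nontrivial
permutation representation of this factor. The theorem therefore amounts to computing these minimal
degrees.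

**Lower bounds.** Let `T` be a perfect group with a homomorphism `T → G`. If `T` has no nontrivial
homomorphism to `S_k` and `G` is `[k]`-solvable, then the image of `T` descends through every factor
of the series of `G`, hence is trivial (`eq_one_of_isKSolvable`). For the groups `PGL_d(K)` and
`PΓL_d(K)` the group `T` is `SL_d(K)`, whose kernel in `G` is its center. The bounds are
obtained in different ways.

* The alternating group `A_n` is simple and too large to embed in `S_k` for `k < n`.
* If the degree is a prime `p`, an element of order `p` acts trivially for `k < p`. For the Mathieu
  groups, `PGL_3(2)`, `PGL_3(3)` and `PGL_5(2)`, two elements `x`, `y` of order `p` for which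
  `x * y` and `x * y ^ 2` have orders prime to `p` generate a group that is perfect and is generated
  by elements of order `p` (`eq_one_of_isKSolvable_of_pow`).
* For `SL_2(p)`, transvections have order `p`.
* For `SL_2(9)`, the root subgroup of order `9` does not embed in `S_5`; for `SL_2(8)` and
  `SL_4(2)`, all nontrivial elements of an elementary abelian subgroup of order `8` are conjugate,
  and Burnside's lemma modulo `8` (`card_dvd_sub_fixCard`) restricts their number of fixed points.
* For `SL_3(4)` and `k ≤ 20`, Burnside's lemma modulo `16` and `64` for the unitriangular matrices
  shows that transvections have exactly four fixed points, and that unitriangular matrices with a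
  single Jordan block have none. The stabilizer of a fixed point then contains an elementary abelian
  group of order `16`, whose at most four fixed points are also fixed by all elements of order `5`
  in its normalizer; this produces a forbidden unitriangular matrix
  (`specialLinearGroup_three_four_hom_eq_one`).

**Exceptional actions.** In four cases the minimal degree is smaller than the degree of the given
action. These are exhibited by the action of `SL_d(K)` on forms by `S ↦ g * S * σ(g)ᵀ`: it permutes
five or seven triples of pairs of quadratic forms for `SL_2(5)` and `SL_2(7)`, and six or eight sets
of differences of Hermitian forms over `F_9` and of alternating forms over `F_2` for `SL_2(9)` and
`SL_4(2)` (`exists_permHom_of_transvections`). The kernel of each of these actions is the center, so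
the image of `SL_d(K)` in `G` embeds in `S_k`, and the quotient by this image is solvable.
-/

/-! ### `[k]`-solvable groups -/

section KSolvable

theorem exists_normal_and_quotient_comm {G : Type*} [Group G] {A B : Subgroup G}
    (h : ∀ a ∈ B, ∀ b ∈ B, a * b * a⁻¹ * b⁻¹ ∈ A) :
    ∃ _ : (A.subgroupOf B).Normal, ∀ a b : B ⧸ A.subgroupOf B, a * b = b * a := by
  have hn : (A.subgroupOf B).Normal := by
    refine ⟨fun x hx g => ?_⟩
    have h1 := A.mul_mem (h g g.2 x x.2) (Subgroup.mem_subgroupOf.1 hx)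
    rw [Subgroup.mem_subgroupOf]
    simpa [mul_assoc] using h1
  refine ⟨hn, fun a b => ?_⟩
  obtain ⟨a, rfl⟩ := QuotientGroup.mk_surjective a
  obtain ⟨b, rfl⟩ := QuotientGroup.mk_surjective b
  rw [← QuotientGroup.mk_mul, ← QuotientGroup.mk_mul, QuotientGroup.eq, Subgroup.mem_subgroupOf]
  have h1 := h b⁻¹ (B.inv_mem b.2) a⁻¹ (B.inv_mem a.2)
  simpa [mul_assoc] using h1

/-- `A` is normal in `B`, and the factor `B / A` is abelian or acts faithfully on a set with at
most `k` elements. -/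
def IsKFactor {G : Type*} [Group G] (k : ℕ) (A B : Subgroup G) : Prop :=
  A ≤ B ∧ ∃ _ : (A.subgroupOf B).Normal,
    (∀ a b : B ⧸ A.subgroupOf B, a * b = b * a) ∨
    ∃ (S : Type) (_ : Fintype S) (_ : MulAction (B ⧸ A.subgroupOf B) S),
      FaithfulSMul (B ⧸ A.subgroupOf B) S ∧ Fintype.card S ≤ k

theorem isKFactor_of_commutator {G : Type*} [Group G] {k : ℕ} {A B : Subgroup G} (hAB : A ≤ B)
    (h : ∀ a ∈ B, ∀ b ∈ B, a * b * a⁻¹ * b⁻¹ ∈ A) : IsKFactor k A B := by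
  obtain ⟨hn, hc⟩ := exists_normal_and_quotient_comm h
  exact ⟨hAB, hn, Or.inl hc⟩

theorem isKFactor_bot {G : Type*} [Group G] {k : ℕ} {S : Type} [Fintype S]
    (hS : Fintype.card S ≤ k) {N : Subgroup G} (f : N →* Equiv.Perm S)
    (hf : Function.Injective f) : IsKFactor k ⊥ N := by
  have hbot : (⊥ : Subgroup G).subgroupOf N = ⊥ := by simp
  have hn : ((⊥ : Subgroup G).subgroupOf N).Normal := by rw [hbot]; infer_instance
  let F : N ⧸ (⊥ : Subgroup G).subgroupOf N →* Equiv.Perm S :=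
    QuotientGroup.lift _ f (by rw [hbot]; exact bot_le)
  have hF : Function.Injective F := by
    rw [← MonoidHom.ker_eq_bot_iff, eq_bot_iff]
    intro x hx
    obtain ⟨x, rfl⟩ := QuotientGroup.mk_surjective x
    have h1 : f x = 1 := hx
    have hx1 : x = 1 := hf (by rw [h1, map_one])
    rw [hx1]
    exact Subgroup.mem_bot.2 rfl
  refine ⟨bot_le, hn, Or.inr ⟨S, inferInstance, MulAction.compHom S F, ?_, hS⟩⟩
  exact @FaithfulSMul.mk _ _ (MulAction.compHom S F).toSMul
    fun {a b} hab => hF (Equiv.ext fun s => hab s)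

theorem isKSolvable_of_isSolvable (k : ℕ) (G : Type*) [Group G] [Group.IsSolvable G] :
    IsKSolvable k G := by
  obtain ⟨m, hm⟩ := (Group.isSolvable_def G).1 inferInstance
  refine ⟨m, fun i => derivedSeries G (m - i), by simpa using hm, by simp, fun i hi => ?_⟩
  change IsKFactor k (derivedSeries G (m - i)) (derivedSeries G (m - (i + 1)))
  obtain ⟨j, rfl⟩ : ∃ j, m = i + 1 + j := ⟨m - (i + 1), by omega⟩
  have h1 : i + 1 + j - i = j + 1 := by omega
  have h2 : i + 1 + j - (i + 1) = j := by omega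
  rw [h1, h2]
  refine isKFactor_of_commutator (derivedSeries_antitone G (Nat.le_succ j)) fun a ha b hb => ?_
  rw [derivedSeries_succ]
  exact Subgroup.commutator_mem_commutator ha hb

/-- A group with a normal series `1 ≤ N ≤ P ≤ G` whose upper two factors are abelian and whose
bottom term acts faithfully on at most `k` elements is `[k]`-solvable. -/
theorem isKSolvable_of_series {G : Type*} [Group G] {k : ℕ} {S : Type} [Fintype S]
    (hS : Fintype.card S ≤ k) {N P : Subgroup G} (hNP : N ≤ P) (f : N →* Equiv.Perm S)
    (hf : Function.Injective f) (hP : ∀ a ∈ P, ∀ b ∈ P, a * b * a⁻¹ * b⁻¹ ∈ N)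
    (hG : ∀ a b : G, a * b * a⁻¹ * b⁻¹ ∈ P) : IsKSolvable k G := by
  refine ⟨3, fun i => match i with | 0 => ⊥ | 1 => N | 2 => P | _ => ⊤, rfl, rfl, ?_⟩
  intro i hi
  interval_cases i
  · exact isKFactor_bot hS f hf
  · exact isKFactor_of_commutator hNP hP
  · exact isKFactor_of_commutator (k := k) (B := ⊤) le_top fun a _ b _ => hG a b

/-- If `φ : T → G` has the same kernel as an action `ψ` of `T` on at most `k` elements, and two
abelian layers lie above the image of `φ`, then `G` is `[k]`-solvable. -/
theorem isKSolvable_of_ker_eq {T G : Type*} [Group T] [Group G] {k : ℕ} {S : Type} [Fintype S]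
    (hS : Fintype.card S ≤ k) (φ : T →* G) (ψ : T →* Equiv.Perm S) (hker : φ.ker = ψ.ker)
    {P : Subgroup G} (hNP : φ.range ≤ P) (hP : ∀ a ∈ P, ∀ b ∈ P, a * b * a⁻¹ * b⁻¹ ∈ φ.range)
    (hG : ∀ a b : G, a * b * a⁻¹ * b⁻¹ ∈ P) : IsKSolvable k G := by
  let f : φ.range →* Equiv.Perm S :=
    (QuotientGroup.kerLift ψ).comp ((QuotientGroup.quotientMulEquivOfEq hker).toMonoidHom.comp
      (QuotientGroup.quotientKerEquivRange φ).symm.toMonoidHom)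
  refine isKSolvable_of_series hS hNP f ?_ hP hG
  exact (QuotientGroup.kerLift_injective ψ).comp
    ((QuotientGroup.quotientMulEquivOfEq hker).injective.comp
      (QuotientGroup.quotientKerEquivRange φ).symm.injective)

/-- A permutation group of at most `k` elements is `[k]`-solvable. -/
theorem isKSolvable_of_card_le {X : Type*} [Fintype X] {k : ℕ} (hk : Fintype.card X ≤ k)
    (G : Subgroup (Equiv.Perm X)) : IsKSolvable k G := by
  let ψ : G →* Equiv.Perm (Fin (Fintype.card X)) :=
    ((Fintype.equivFin X).permCongrHom.toMonoidHom).comp G.subtype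
  have hψ : Function.Injective ψ :=
    (Fintype.equivFin X).permCongrHom.injective.comp G.subtype_injective
  refine isKSolvable_of_ker_eq (by simpa using hk) (MonoidHom.id G) ψ ?_ (P := ⊤) le_top
    (fun a _ b _ => ⟨_, rfl⟩) (fun a b => trivial)
  rw [(MonoidHom.ker_eq_bot_iff ψ).2 hψ, (MonoidHom.ker_eq_bot_iff _).2 fun a b h => h]

/-- A perfect group `T` without nontrivial action on `k` elements maps trivially to every
`[k]`-solvable group: its image can be pushed down the series step by step. -/
theorem eq_one_of_isKSolvable {T G : Type*} [Group T] [Group G] {k : ℕ} (hG : IsKSolvable k G)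
    (hT : commutator T = ⊤) (hk : ∀ f : T →* Equiv.Perm (Fin k), f = 1) (φ : T →* G) : φ = 1 := by
  obtain ⟨m, H, h0, hm, h⟩ := hG
  have key : ∀ j ≤ m, ∀ t, φ t ∈ H (m - j) := by
    intro j
    induction j with
    | zero => intro _ t; simp [hm]
    | succ j ih =>
      intro hj t
      obtain ⟨i, rfl⟩ : ∃ i, m = i + 1 + j := ⟨m - (j + 1), by omega⟩
      have h1 : i + 1 + j - j = i + 1 := by omega
      have h2 : i + 1 + j - (j + 1) = i := by omega
      rw [h1] at ih
      rw [h2]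
      obtain ⟨-, hn, hcase⟩ := h i (by omega)
      let F : T →* H (i + 1) ⧸ (H i).subgroupOf (H (i + 1)) :=
        (QuotientGroup.mk' _).comp (φ.codRestrict (H (i + 1)) (ih (by omega)))
      have hF : F t = 1 := by
        rcases hcase with hc | ⟨S, hS, hact, hfaith, hcard⟩
        · have : t ∈ commutator T := hT ▸ Subgroup.mem_top t
          have hle : commutator T ≤ F.ker := by
            rw [commutator_def, Subgroup.commutator_le]
            intro a _ b _
            rw [MonoidHom.mem_ker, map_commutatorElement, commutatorElement_eq_one_iff_mul_comm]
            exact hc _ _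
          exact hle this
        · let e : S ↪ Fin k := (Fintype.equivFin S).toEmbedding.trans (Fin.castLEEmb hcard)
          have hp : ∀ g : T, MulAction.toPermHom _ S (F g) = 1 := by
            intro g
            have h3 := DFunLike.congr_fun (hk ((Equiv.Perm.viaEmbeddingHom e).comp
              ((MulAction.toPermHom _ S).comp F))) g
            exact Equiv.Perm.viaEmbeddingHom_injective e (by rw [map_one]; exact h3)
          refine hfaith.eq_of_smul_eq_smul (α := S) fun s => ?_
          rw [one_smul]
          exact DFunLike.congr_fun (hp t) s
      exact Subgroup.mem_subgroupOf.1 ((QuotientGroup.eq_one_iff _).1 hF)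
  ext t
  have := key m le_rfl t
  simpa [h0] using this

theorem perm_eq_one_of_pow_prime {α : Type*} [Finite α] {p : ℕ} (hp : p.Prime)
    (hα : Nat.card α < p) {σ : Equiv.Perm α} (hσ : σ ^ p = 1) : σ = 1 := by
  have h1 : orderOf σ ∣ p := orderOf_dvd_of_pow_eq_one hσ
  have h2 : orderOf σ ∣ (Nat.card α).factorial := by
    have := orderOf_dvd_natCard (x := σ)
    rwa [Nat.card_perm] at this
  rcases (Nat.dvd_prime hp).1 h1 with h | h
  · exact orderOf_eq_one_iff.1 h
  · rw [h, hp.dvd_factorial] at h2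
    omega

theorem perm_fin_eq_one_of_pow_prime {p k : ℕ} (hp : p.Prime) (hk : k < p)
    {σ : Equiv.Perm (Fin k)} (hσ : σ ^ p = 1) : σ = 1 :=
  perm_eq_one_of_pow_prime hp (by rwa [Nat.card_fin]) hσ

theorem eq_one_of_pow_coprime {A : Type*} [Group A] {u : A} {p a : ℕ} (hp : u ^ p = 1)
    (ha : u ^ a = 1) (h : p.Coprime a) : u = 1 := by
  rw [← orderOf_eq_one_iff, ← Nat.dvd_one, ← h.gcd_eq_one]
  exact Nat.dvd_gcd (orderOf_dvd_of_pow_eq_one hp) (orderOf_dvd_of_pow_eq_one ha)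

/-- If two elements `x`, `y` of prime order `p > k` have products `x * y` and `x * y ^ 2` of order
prime to `p`, the group they generate is perfect and does not act on `k` elements, so no
`[k]`-solvable group contains a nontrivial image of it. -/
theorem eq_one_of_isKSolvable_of_pow {T G : Type*} [Group T] [Group G] {k : ℕ}
    (hG : IsKSolvable k G) (φ : T →* G) {p a b : ℕ} (hp : p.Prime) (hk : k < p) {x y : T}
    (hx : x ^ p = 1) (hy : y ^ p = 1) (hxy : (x * y) ^ a = 1) (hxyy : (x * y ^ 2) ^ b = 1)
    (ha : p.Coprime a) (hb : p.Coprime b) : φ x = 1 := by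
  let s : Set T := {x, y}
  let x' : Subgroup.closure s := ⟨x, Subgroup.subset_closure (by simp [s])⟩
  let y' : Subgroup.closure s := ⟨y, Subgroup.subset_closure (by simp [s])⟩
  have htop : ∀ K : Subgroup (Subgroup.closure s), x' ∈ K → y' ∈ K → K = ⊤ := by
    intro K h1 h2
    rw [eq_top_iff, ← Subgroup.closure_closure_coe_preimage (k := s), Subgroup.closure_le]
    intro z hz
    rcases hz with hz | hz
    · rwa [show z = x' from Subtype.ext hz]
    · rwa [show z = y' from Subtype.ext hz]
  have hx' : x' ^ p = 1 := Subtype.ext hx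
  have hy' : y' ^ p = 1 := Subtype.ext hy
  have hxy' : (x' * y') ^ a = 1 := Subtype.ext hxy
  have hxyy' : (x' * y' ^ 2) ^ b = 1 := Subtype.ext hxyy
  have h1 : commutator (Subgroup.closure s) = ⊤ := by
    set q := Abelianization.of (G := Subgroup.closure s)
    have e1 : q x' * q y' = 1 := eq_one_of_pow_coprime (p := p)
      (by rw [mul_pow, ← map_pow, ← map_pow, hx', hy']; simp)
      (by rw [← map_mul, ← map_pow, hxy', map_one]) ha
    have e2 : q x' * q y' ^ 2 = 1 := eq_one_of_pow_coprime (p := p)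
      (by rw [mul_pow, ← pow_mul, mul_comm 2 p, pow_mul, ← map_pow, ← map_pow, hx', hy']; simp)
      (by rw [← map_pow, ← map_mul, ← map_pow, hxyy', map_one]) hb
    have e3 : q y' = 1 := by rwa [pow_two, ← mul_assoc, e1, one_mul] at e2
    have e4 : q x' = 1 := by rwa [e3, mul_one] at e1
    exact htop _ ((QuotientGroup.eq_one_iff _).1 e4) ((QuotientGroup.eq_one_iff _).1 e3)
  have h2 : ∀ f : Subgroup.closure s →* Equiv.Perm (Fin k), f = 1 := by
    intro f
    rw [← MonoidHom.ker_eq_top_iff]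
    refine htop _ ?_ ?_ <;> rw [MonoidHom.mem_ker]
    · exact perm_fin_eq_one_of_pow_prime hp hk (by rw [← map_pow, hx', map_one])
    · exact perm_fin_eq_one_of_pow_prime hp hk (by rw [← map_pow, hy', map_one])
  have := eq_one_of_isKSolvable hG h1 h2 (φ.comp (Subgroup.closure s).subtype)
  exact DFunLike.congr_fun this x'

end KSolvable

/-! ### Symmetric, alternating, dihedral and Mathieu groups -/

section Permutation

/-- The simple group `A_n` cannot embed in `S_k` for `k < n`, because `2 * k! < n!`. -/
theorem card_le_of_alternatingGroup_le {X : Type*} [Fintype X] [DecidableEq X]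
    (hX : 5 ≤ Fintype.card X) {G : Subgroup (Equiv.Perm X)} (hG : alternatingGroup X ≤ G) {k : ℕ}
    (hk : IsKSolvable k G) : Fintype.card X ≤ k := by
  by_contra! hlt
  have hX' : 5 ≤ Nat.card X := by rwa [Nat.card_eq_fintype_card]
  have := alternatingGroup.isSimpleGroup hX'
  have hperm : ∀ f : alternatingGroup X →* Equiv.Perm (Fin k), f = 1 := by
    intro f
    rcases f.normal_ker.eq_bot_or_eq_top with h | h
    · have hinj := (MonoidHom.ker_eq_bot_iff f).1 h
      have h1 := Fintype.card_le_of_injective f hinj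
      rw [Fintype.card_perm, Fintype.card_fin] at h1
      have : Nontrivial X := Fintype.one_lt_card_iff_nontrivial.1 (by omega)
      have h2 := two_mul_card_alternatingGroup (α := X)
      rw [Fintype.card_perm] at h2
      obtain ⟨n, hn⟩ : ∃ n, Fintype.card X = n + 1 := ⟨Fintype.card X - 1, by omega⟩
      rw [hn, Nat.factorial_succ] at h2
      have h3 : k.factorial ≤ n.factorial := Nat.factorial_le (by omega)
      have h4 := Nat.factorial_pos n
      nlinarith
    · exact MonoidHom.ker_eq_top_iff.1 h
  have h := eq_one_of_isKSolvable hk (commutator_alternatingGroup_eq_top hX') hperm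
    (Subgroup.inclusion hG)
  have hnt : Nontrivial (alternatingGroup X) :=
    alternatingGroup.nontrivial_of_three_le_card (by omega)
  obtain ⟨a, ha⟩ := exists_ne (1 : alternatingGroup X)
  exact ha (Subgroup.inclusion_injective hG (by rw [h]; rfl))

/-- The derived subgroup of `A_4` is the Klein four-group, which is abelian. -/
theorem isSolvable_perm_fin_four : Group.IsSolvable (Equiv.Perm (Fin 4)) := by
  have h4 : Nat.card (Fin 4) = 4 := by simp
  have hV : Group.IsSolvable (alternatingGroup.kleinFour (Fin 4)) := by
    have := alternatingGroup.kleinFour_isKleinFour h4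
    exact Group.isSolvable_of_comm fun a b => mul_comm_of_exponent_two this.exponent_two a b
  have hQ : Group.IsSolvable (alternatingGroup (Fin 4)) := by
    rw [alternatingGroup.kleinFour_eq_commutator h4] at hV
    rw [Group.isSolvable_iff_subgroup_quotient (commutator (alternatingGroup (Fin 4)))]
    exact ⟨hV, inferInstanceAs (Group.IsSolvable (Abelianization (alternatingGroup (Fin 4))))⟩
  exact Group.isSolvable_of_ker_le_range (alternatingGroup (Fin 4)).subtype
    (Equiv.Perm.sign (α := Fin 4)) (by rw [Subgroup.range_subtype]; exact le_rfl)

theorem isSolvable_perm {X : Type*} [Fintype X] (hX : Fintype.card X ≤ 4) :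
    Group.IsSolvable (Equiv.Perm X) := by
  let e : X ↪ Fin 4 := (Fintype.equivFin X).toEmbedding.trans (Fin.castLEEmb hX)
  have := isSolvable_perm_fin_four
  exact Group.isSolvable_of_isSolvable_injective (Equiv.Perm.viaEmbeddingHom_injective e)

/-- Commutators of maps `x ↦ ± x + b` are shifts, and shifts commute. -/
theorem isSolvable_plusMinusGroup (n : ℕ) : Group.IsSolvable (plusMinusGroup n) := by
  have hmem : ∀ {σ}, σ ∈ plusMinusGroup n →
      ∃ ε b : ZMod n, ε * ε = 1 ∧ (∀ x, σ x = ε * x + b) ∧ ∀ x, σ⁻¹ x = ε * (x - b) := by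
    have aux : ∀ (σ : Equiv.Perm (ZMod n)) (ε b : ZMod n), ε * ε = 1 → (∀ x, σ x = ε * x + b) →
        ε * ε = 1 ∧ (∀ x, σ x = ε * x + b) ∧ ∀ x, σ⁻¹ x = ε * (x - b) := by
      refine fun σ ε b hε h => ⟨hε, h, fun x => ?_⟩
      rw [Equiv.Perm.inv_eq_iff_eq, h]
      linear_combination (b - x) * hε
    rintro σ ⟨b, h | h⟩
    · exact ⟨1, b, aux σ 1 b (by ring) fun x => by rw [h]; ring⟩
    · exact ⟨-1, b, aux σ (-1) b (by ring) fun x => by rw [h]; ring⟩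
  have h1 : commutator (plusMinusGroup n) ≤ (shiftGroup n).subgroupOf (plusMinusGroup n) := by
    rw [commutator_def, Subgroup.commutator_le]
    rintro ⟨a, ha⟩ - ⟨b, hb⟩ -
    rw [Subgroup.mem_subgroupOf]
    obtain ⟨ε, c, hε, ha, ha'⟩ := hmem ha
    obtain ⟨δ, d, hδ, hb, hb'⟩ := hmem hb
    -- the signs of `a` and `b` cancel in the commutator
    refine ⟨-d - δ * c + ε * d + c, fun x => ?_⟩
    change a (b (a⁻¹ (b⁻¹ x))) = _
    rw [ha, hb, ha', hb']
    linear_combination (δ * δ * (x - d) - δ * c) * hε + (x - d) * hδ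
  rw [Group.isSolvable_def]
  refine ⟨2, ?_⟩
  rw [derivedSeries_succ, derivedSeries_one, eq_bot_iff, Subgroup.commutator_le]
  intro a ha b hb
  obtain ⟨c, hc⟩ := h1 ha
  obtain ⟨d, hd⟩ := h1 hb
  rw [Subgroup.mem_bot, commutatorElement_eq_one_iff_mul_comm]
  refine Subtype.ext (Equiv.ext fun x => ?_)
  change a.1 (b.1 x) = b.1 (a.1 x)
  simp only [Subgroup.subtype_apply] at hc hd
  rw [hc, hd, hc, hd]
  ring

/-- Groups that differ by a relabelling are isomorphic. -/
theorem PermIso.mulEquiv {X Y : Type*} {G : Subgroup (Equiv.Perm X)} {H : Subgroup (Equiv.Perm Y)}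
    (h : PermIso G H) : Nonempty (G ≃* H) := by
  obtain ⟨e, he⟩ := h
  have : H = G.map e.permCongrHom.toMonoidHom := by
    ext σ
    constructor
    · intro hσ
      have h1 : e.permCongr (e.permCongr.symm σ) = σ := e.permCongr.apply_symm_apply σ
      exact ⟨e.permCongr.symm σ, (he _).2 (by rwa [h1]), h1⟩
    · rintro ⟨τ, hτ, rfl⟩
      exact (he τ).1 hτ
  rw [this]
  exact ⟨e.permCongrHom.subgroupMap G⟩

theorem PermIso.card_eq {X Y : Type*} {G : Subgroup (Equiv.Perm X)} {H : Subgroup (Equiv.Perm Y)}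
    (h : PermIso G H) : Nat.card X = Nat.card Y :=
  Nat.card_congr h.choose

theorem isSolvable_of_isBetweenCyclicAndDihedral {X : Type*} {n : ℕ} {G : Subgroup (Equiv.Perm X)}
    (h : IsBetweenCyclicAndDihedral n G) : Group.IsSolvable G := by
  obtain ⟨H, -, hH, hGH⟩ := h
  obtain ⟨e⟩ := hGH.mulEquiv
  have := isSolvable_plusMinusGroup n
  exact Group.isSolvable_of_isSolvable_injective
    (f := (Subgroup.inclusion hH).comp e.toMonoidHom)
    ((Subgroup.inclusion_injective hH).comp e.injective)

theorem isBetweenCyclicAndDihedral_alternatingGroup {X : Type*} [Fintype X] [DecidableEq X]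
    (hX : Fintype.card X = 3) : IsBetweenCyclicAndDihedral 3 (alternatingGroup X) := by
  have h3 : Fintype.card X = Fintype.card (ZMod 3) := by rw [hX, ZMod.card]
  refine ⟨shiftGroup 3, le_rfl, ?_, Fintype.equivOfCardEq h3, fun σ => ?_⟩
  · rintro σ ⟨b, hb⟩
    exact ⟨b, Or.inl hb⟩
  · have key : ∀ τ : Equiv.Perm (ZMod 3), Equiv.Perm.sign τ = 1 ↔ ∃ b, ∀ x, τ x = x + b := by
      decide
    rw [Equiv.Perm.mem_alternatingGroup, ← Equiv.Perm.sign_permCongr (Fintype.equivOfCardEq h3)]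
    exact key _

/-- In `M_11`, the `11`-cycle `x` among the generators and its conjugate `y` by the square of the
other generator have products `x * y` and `x * y ^ 2` of orders `3` and `2`. -/
theorem PermIso.eleven_le_of_isKSolvable {X : Type*} {G : Subgroup (Equiv.Perm X)}
    (hG : PermIso G mathieuEleven) {k : ℕ} (h : IsKSolvable k G) : 11 ≤ k := by
  by_contra! hk
  obtain ⟨e⟩ := hG.mulEquiv
  let b : Equiv.Perm (Fin 11) := List.formPerm [2, 6, 10, 7] * List.formPerm [3, 9, 4, 5]
  have hx : finRotate 11 ∈ mathieuEleven := Subgroup.subset_closure (by simp)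
  have hb : b ∈ mathieuEleven := Subgroup.subset_closure (by simp [b])
  have hy : b ^ 2 * finRotate 11 * (b ^ 2)⁻¹ ∈ mathieuEleven :=
    mul_mem (mul_mem (pow_mem hb 2) hx) (inv_mem (pow_mem hb 2))
  have := eq_one_of_isKSolvable_of_pow h e.symm.toMonoidHom (p := 11) (a := 3) (b := 2)
    (by norm_num) hk (x := ⟨_, hx⟩) (y := ⟨_, hy⟩) (Subtype.ext ?_) (Subtype.ext ?_)
    (Subtype.ext ?_) (Subtype.ext ?_) (by norm_num) (by norm_num)
  · have h0 := congrArg (fun σ : Equiv.Perm (Fin 11) => σ 0)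
      (congrArg Subtype.val ((map_eq_one_iff e.symm e.symm.injective).1 this))
    exact absurd h0 (by simp)
  -- the relations are identities between explicit permutations
  all_goals
    simp only [Subgroup.coe_mul, Subgroup.coe_pow, Subgroup.coe_one, b]
    decide +kernel

/-- In `M_23`, the `23`-cycle `x` among the generators and its conjugate `y` by the other generator
have products `x * y` and `x * y ^ 2` of orders `15` and `6`. -/
theorem PermIso.twentyThree_le_of_isKSolvable {X : Type*} {G : Subgroup (Equiv.Perm X)}
    (hG : PermIso G mathieuTwentyThree) {k : ℕ} (h : IsKSolvable k G) : 23 ≤ k := by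
  by_contra! hk
  obtain ⟨e⟩ := hG.mulEquiv
  let b : Equiv.Perm (Fin 23) := List.formPerm [2, 16, 9, 6, 8] *
    List.formPerm [3, 12, 13, 18, 4] * List.formPerm [7, 17, 10, 11, 22] *
      List.formPerm [14, 19, 21, 20, 15]
  have hx : finRotate 23 ∈ mathieuTwentyThree := Subgroup.subset_closure (by simp)
  have hb : b ∈ mathieuTwentyThree := Subgroup.subset_closure (by simp [b])
  have hy : b * finRotate 23 * b⁻¹ ∈ mathieuTwentyThree := mul_mem (mul_mem hb hx) (inv_mem hb)
  have := eq_one_of_isKSolvable_of_pow h e.symm.toMonoidHom (p := 23) (a := 15) (b := 6)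
    (by norm_num) hk (x := ⟨_, hx⟩) (y := ⟨_, hy⟩) (Subtype.ext ?_) (Subtype.ext ?_)
    (Subtype.ext ?_) (Subtype.ext ?_) (by norm_num) (by norm_num)
  · have h0 := congrArg (fun σ : Equiv.Perm (Fin 23) => σ 0)
      (congrArg Subtype.val ((map_eq_one_iff e.symm e.symm.injective).1 this))
    exact absurd h0 (by simp)
  all_goals
    simp only [Subgroup.coe_mul, Subgroup.coe_pow, Subgroup.coe_one, b]
    decide +kernel

end Permutation

/-! ### The linear groups as images of `SL_d(K)` -/

section LinearModel

variable {K : Type*} [Field K] {d : ℕ}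

/-- A linear automorphism mapping every vector to a multiple of itself is a homothety. -/
theorem exists_smul_of_forall_mem_span {f : (Fin d → K) ≃ₗ[K] (Fin d → K)}
    (h : ∀ v, f v ∈ Submodule.span K {v}) : ∃ c : K, ∀ v, f v = c • v := by
  obtain ⟨a, ha⟩ := f.toLinearMap.exists_eq_smul_id_of_forall_notLinearIndependent fun v => by
    by_cases hv : v = 0
    · simp [hv, linearIndependent_fin2]
    · obtain ⟨c, hc⟩ := Submodule.mem_span_singleton.1 (h v)
      rw [LinearIndependent.pair_iff' hv]
      push Not
      exact ⟨c, hc⟩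
  exact ⟨a, fun v => DFunLike.congr_fun ha v⟩

/-- The action of the linear automorphisms of `K^d` on the points of the projective space. -/
def pointsHom (d : ℕ) (K : Type*) [Field K] :
    ((Fin d → K) ≃ₗ[K] (Fin d → K)) →* Equiv.Perm (ℙ K (Fin d → K)) :=
  MulAction.toPermHom _ _

theorem pointsHom_mk (f : (Fin d → K) ≃ₗ[K] (Fin d → K)) {v : Fin d → K} (hv : v ≠ 0) :
    pointsHom d K f (.mk K v hv) = .mk K (f v) ((f.map_ne_zero_iff).2 hv) := rfl

theorem pointsHom_eq_one_iff (f : (Fin d → K) ≃ₗ[K] (Fin d → K)) :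
    pointsHom d K f = 1 ↔ ∃ c : K, ∀ v, f v = c • v := by
  constructor
  · intro h
    refine exists_smul_of_forall_mem_span fun v => ?_
    by_cases hv : v = 0
    · simp [hv]
    · have h1 := DFunLike.congr_fun h (.mk K v hv)
      rw [pointsHom_mk, Equiv.Perm.one_apply, Projectivization.mk_eq_mk_iff'] at h1
      exact Submodule.mem_span_singleton.2 h1
  · rintro ⟨c, hc⟩
    ext p
    induction p using Projectivization.ind with
    | h v hv =>
      rw [pointsHom_mk, Equiv.Perm.one_apply, Projectivization.mk_eq_mk_iff']
      exact ⟨c, (hc v).symm⟩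

theorem isCoatom_map (f : (Fin d → K) ≃ₗ[K] (Fin d → K)) {W : Submodule K (Fin d → K)}
    (hW : IsCoatom W) : IsCoatom (W.map (f : (Fin d → K) →ₗ[K] (Fin d → K))) :=
  ((Submodule.orderIsoMapComap f).isCoatom_iff W).2 hW

/-- The action of the linear automorphisms of `K^d` on the hyperplanes of the projective space. -/
def hyperplanesHom (d : ℕ) (K : Type*) [Field K] :
    ((Fin d → K) ≃ₗ[K] (Fin d → K)) →* Equiv.Perm (Hyperplane K (Fin d → K)) where
  toFun f :=
    { toFun := fun W => ⟨W.1.map (f : (Fin d → K) →ₗ[K] (Fin d → K)), isCoatom_map f W.2⟩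
      invFun := fun W => ⟨W.1.map (f.symm : (Fin d → K) →ₗ[K] (Fin d → K)),
        isCoatom_map f.symm W.2⟩
      left_inv := fun W => Subtype.ext (by
        change Submodule.map _ (Submodule.map _ _) = _
        rw [← Submodule.map_comp]; simp)
      right_inv := fun W => Subtype.ext (by
        change Submodule.map _ (Submodule.map _ _) = _
        rw [← Submodule.map_comp]; simp) }
  map_one' := Equiv.ext fun W => Subtype.ext (Submodule.map_id _)
  map_mul' f g := Equiv.ext fun W => Subtype.ext (Submodule.map_comp _ _ _)

theorem mem_hyperplanesHom_iff (f : (Fin d → K) ≃ₗ[K] (Fin d → K))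
    (W : Hyperplane K (Fin d → K)) (v : Fin d → K) :
    f v ∈ (hyperplanesHom d K f W).1 ↔ v ∈ W.1 := by
  change f v ∈ W.1.map (f : (Fin d → K) →ₗ[K] (Fin d → K)) ↔ _
  rw [Submodule.mem_map_equiv, f.symm_apply_apply]

theorem eq_hyperplanesHom {σ : Equiv.Perm (Hyperplane K (Fin d → K))}
    {f : (Fin d → K) ≃ₗ[K] (Fin d → K)} (h : ∀ W v, f v ∈ (σ W).1 ↔ v ∈ W.1) :
    hyperplanesHom d K f = σ := by
  refine Equiv.ext fun W => Subtype.ext (Submodule.ext fun v => ?_)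
  obtain ⟨v, rfl⟩ := f.surjective v
  rw [mem_hyperplanesHom_iff, h]

theorem hyperplanesHom_eq_one_iff (f : (Fin d → K) ≃ₗ[K] (Fin d → K)) :
    hyperplanesHom d K f = 1 ↔ ∃ c : K, ∀ v, f v = c • v := by
  constructor
  · intro h
    refine exists_smul_of_forall_mem_span fun v => ?_
    by_contra hv
    -- a linear form vanishing at `v` but not at `f v` has a hyperplane as its kernel
    obtain ⟨g, hg, hg'⟩ := Submodule.exists_dual_map_eq_bot_of_notMem hv inferInstance
    have hgv : v ∈ LinearMap.ker g := by
      have h1 := Submodule.mem_map_of_mem (f := g) (Submodule.mem_span_singleton_self v)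
      rwa [hg', Submodule.mem_bot] at h1
    have hW : IsCoatom (LinearMap.ker g) :=
      LinearMap.isCoatom_ker_of_surjective
        (LinearMap.surjective fun h0 => hg (by rw [h0]; rfl))
    have h1 := mem_hyperplanesHom_iff f ⟨LinearMap.ker g, hW⟩ v
    rw [h] at h1
    exact hg (h1.2 hgv)
  · rintro ⟨c, hc⟩
    refine eq_hyperplanesHom fun W v => ?_
    rw [hc, Equiv.Perm.one_apply]
    by_cases h0 : c = 0
    · have hv : v = 0 := f.injective (by rw [hc, h0, zero_smul, map_zero])
      simp [hv]
    · exact W.1.smul_mem_iff h0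

theorem ringEquiv_comm_of_finite [Finite K] (s t : K ≃+* K) (x : K) : s (t x) = t (s x) := by
  by_cases hx : x = 0
  · simp [hx]
  obtain ⟨m, hm⟩ := MonoidHom.map_cyclic (Units.map (s : K →* K))
  obtain ⟨n, hn⟩ := MonoidHom.map_cyclic (Units.map (t : K →* K))
  have h1 : Units.map (s : K →* K) (Units.map (t : K →* K) (Units.mk0 x hx)) =
      Units.map (t : K →* K) (Units.map (s : K →* K) (Units.mk0 x hx)) := by
    rw [hm, hn, hn, hm, ← zpow_mul, ← zpow_mul, mul_comm]
  simpa using congrArg Units.val h1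

/-- The commutator of two semilinear automorphisms of `K^d` over a finite field is linear, because
the automorphisms of a finite field commute. -/
theorem exists_linearEquiv_commutator [Finite K] {s t : K ≃+* K}
    {f g : (Fin d → K) ≃+ (Fin d → K)} (hf : ∀ (c : K) v, f (c • v) = s c • f v)
    (hg : ∀ (c : K) v, g (c • v) = t c • g v) :
    ∃ F : (Fin d → K) ≃ₗ[K] (Fin d → K), ∀ v, F (g (f v)) = f (g v) := by
  have hf' : ∀ (c : K) v, f.symm (c • v) = s.symm c • f.symm v := fun c v => by
    rw [AddEquiv.symm_apply_eq, hf]; simp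
  have hg' : ∀ (c : K) v, g.symm (c • v) = t.symm c • g.symm v := fun c v => by
    rw [AddEquiv.symm_apply_eq, hg]; simp
  refine ⟨{ (g.symm.trans f.symm).trans (g.trans f) with
    map_smul' := fun c v => ?_ }, fun v => ?_⟩
  · change f (g (f.symm (g.symm (c • v)))) = c • f (g (f.symm (g.symm v)))
    rw [hg', hf', hg, hf]
    congr 1
    rw [ringEquiv_comm_of_finite s t]
    simp
  · change f (g (f.symm (g.symm (g (f v))))) = f (g v)
    simp

theorem pointsHom_range (d : ℕ) (K : Type*) [Field K] :
    (MulAction.toPermHom PGL(d, K) (ℙ K (Fin d → K))).range = (pointsHom d K).range := by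
  ext σ
  constructor
  · rintro ⟨g, rfl⟩
    obtain ⟨g, rfl⟩ := QuotientGroup.mk_surjective g
    refine ⟨DistribMulAction.toLinearEquiv K (Fin d → K) g, Equiv.ext fun p => ?_⟩
    induction p using Projectivization.ind with | h v hv => rfl
  · rintro ⟨f, rfl⟩
    let g : GL (Fin d) K := Matrix.GeneralLinearGroup.toLin.symm
      (LinearMap.GeneralLinearGroup.ofLinearEquiv f)
    refine ⟨Matrix.ProjGenLinGroup.mk g, Equiv.ext fun p => ?_⟩
    induction p using Projectivization.ind with
    | h v hv =>
      have h1 : g • v = f v := by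
        change (LinearMap.toMatrix' f.toLinearMap).mulVec v = f v
        rw [LinearMap.toMatrix'_mulVec]; rfl
      change Projectivization.mk K (g • v) _ = Projectivization.mk K (f v) _
      simp only [h1]

theorem pglHyperplanes_eq_range (d : ℕ) (K : Type*) [Field K] :
    pglHyperplanes d K = (hyperplanesHom d K).range := by
  ext σ
  constructor
  · rintro ⟨f, hf⟩
    exact ⟨f, eq_hyperplanesHom hf⟩
  · rintro ⟨f, rfl⟩
    exact ⟨f, mem_hyperplanesHom_iff f⟩

theorem pointsHom_range_le (d : ℕ) (K : Type*) [Field K] :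
    (pointsHom d K).range ≤ pGammaLPoints d K := by
  rintro _ ⟨f, rfl⟩
  exact ⟨RingEquiv.refl K, f.toAddEquiv, fun c v => f.map_smul c v, fun v hv => rfl⟩

theorem hyperplanesHom_range_le (d : ℕ) (K : Type*) [Field K] :
    (hyperplanesHom d K).range ≤ pGammaLHyperplanes d K := by
  rintro _ ⟨f, rfl⟩
  exact ⟨RingEquiv.refl K, f.toAddEquiv, fun c v => f.map_smul c v, mem_hyperplanesHom_iff f⟩

theorem commutator_mem_pointsHom_range [Finite K] {σ τ : Equiv.Perm (ℙ K (Fin d → K))}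
    (hσ : σ ∈ pGammaLPoints d K) (hτ : τ ∈ pGammaLPoints d K) :
    σ * τ * σ⁻¹ * τ⁻¹ ∈ (pointsHom d K).range := by
  obtain ⟨s, f, hf, hσ⟩ := hσ
  obtain ⟨t, g, hg, hτ⟩ := hτ
  obtain ⟨F, hF⟩ := exists_linearEquiv_commutator hf hg
  refine ⟨F, ?_⟩
  rw [eq_mul_inv_iff_mul_eq, eq_mul_inv_iff_mul_eq]
  refine Equiv.ext fun p => ?_
  induction p using Projectivization.ind with
  | h v hv =>
    simp only [Equiv.Perm.mul_apply, hσ, hτ, pointsHom_mk, hF]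

theorem commutator_mem_hyperplanesHom_range [Finite K]
    {σ τ : Equiv.Perm (Hyperplane K (Fin d → K))}
    (hσ : σ ∈ pGammaLHyperplanes d K) (hτ : τ ∈ pGammaLHyperplanes d K) :
    σ * τ * σ⁻¹ * τ⁻¹ ∈ (hyperplanesHom d K).range := by
  obtain ⟨s, f, hf, hσ⟩ := hσ
  obtain ⟨t, g, hg, hτ⟩ := hτ
  obtain ⟨F, hF⟩ := exists_linearEquiv_commutator hf hg
  refine ⟨F, eq_hyperplanesHom fun W v => ?_⟩
  obtain ⟨v, rfl⟩ := g.surjective v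
  obtain ⟨v, rfl⟩ := f.surjective v
  obtain ⟨W, rfl⟩ := τ.surjective W
  obtain ⟨W, rfl⟩ := σ.surjective W
  rw [hF]
  simp [hσ, hτ]

/-- `G` contains the image of `SL_d(K)` under a homomorphism whose kernel is the center, that is, a
copy of `PSL_d(K)`, and two abelian layers lie above it: the quotients of a subgroup `P` by this
copy and of `G` by `P`. For `PΓL_d(K)` the subgroup `P` is the copy of `PGL_d(K)`. -/
def IsExtensionOfPSL (d : ℕ) (K : Type*) [Field K] (G : Type*) [Group G] : Prop :=
  ∃ (φ : SL(d, K) →* G) (P : Subgroup G), φ.ker = Subgroup.center SL(d, K) ∧ φ.range ≤ P ∧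
    (∀ a ∈ P, ∀ b ∈ P, a * b * a⁻¹ * b⁻¹ ∈ φ.range) ∧ ∀ a b : G, a * b * a⁻¹ * b⁻¹ ∈ P

/-- The criterion applies to both actions, on points and on hyperplanes: `α` is the action of the
linear automorphisms, with the homotheties as its kernel, and `H` is the group of all permutations
under consideration. -/
theorem isExtensionOfPSL_of_permIso {X Y : Type*} {G : Subgroup (Equiv.Perm X)}
    {H : Subgroup (Equiv.Perm Y)} (hGH : PermIso G H)
    (α : ((Fin d → K) ≃ₗ[K] (Fin d → K)) →* Equiv.Perm Y)
    (hα : ∀ f, α f = 1 ↔ ∃ c : K, ∀ v, f v = c • v) (hle : α.range ≤ H)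
    (hcomm : ∀ σ ∈ H, ∀ τ ∈ H, σ * τ * σ⁻¹ * τ⁻¹ ∈ α.range) : IsExtensionOfPSL d K G := by
  obtain ⟨e⟩ := hGH.mulEquiv
  let β : ((Fin d → K) ≃ₗ[K] (Fin d → K)) →* G :=
    e.symm.toMonoidHom.comp (α.codRestrict H fun f => hle ⟨f, rfl⟩)
  have hβ : ∀ f, ((e (β f) : H) : Equiv.Perm Y) = α f := fun f => by simp [β]
  refine ⟨β.comp Matrix.SpecialLinearGroup.toLin', β.range, ?_, ?_, ?_, ?_⟩
  · ext A
    have h1 : β.comp Matrix.SpecialLinearGroup.toLin' A = 1 ↔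
        α (Matrix.SpecialLinearGroup.toLin' A) = 1 := by
      rw [← hβ, ← e.map_eq_one_iff, ← Subtype.coe_inj]; rfl
    rw [MonoidHom.mem_ker, h1, hα, Matrix.SpecialLinearGroup.mem_center_iff]
    constructor
    · rintro ⟨c, hc⟩
      have h2 : Matrix.scalar (Fin d) c = A.1 := by
        refine Matrix.toLin'.injective (LinearMap.ext fun v => ?_)
        rw [Matrix.toLin'_apply, Matrix.toLin'_apply, Matrix.scalar_apply]
        have := hc v
        rw [Matrix.SpecialLinearGroup.toLin'_apply] at this
        rw [← Matrix.toLin'_apply A.1, this]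
        ext i
        simp [Matrix.mulVec_diagonal]
      refine ⟨c, ?_, h2⟩
      have := A.2
      rw [← h2] at this
      simpa using this
    · rintro ⟨c, -, hc⟩
      refine ⟨c, fun v => ?_⟩
      rw [Matrix.SpecialLinearGroup.toLin'_apply, Matrix.toLin'_apply, ← hc]
      ext i
      simp [Matrix.mulVec_diagonal]
  · rintro _ ⟨A, rfl⟩
    exact ⟨_, rfl⟩
  · rintro _ ⟨f, rfl⟩ _ ⟨g, rfl⟩
    let A : SL(d, K) := ⟨LinearMap.toMatrix' (f * g * f⁻¹ * g⁻¹).toLinearMap, by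
      rw [LinearMap.det_toMatrix', ← LinearEquiv.coe_det, map_mul, map_mul, map_mul, map_inv,
        map_inv, mul_comm (LinearEquiv.det f)]
      simp⟩
    refine ⟨A, ?_⟩
    have hA : Matrix.SpecialLinearGroup.toLin' A = f * g * f⁻¹ * g⁻¹ := by
      refine LinearEquiv.ext fun v => ?_
      rw [Matrix.SpecialLinearGroup.toLin'_apply, Matrix.toLin'_toMatrix']; rfl
    rw [MonoidHom.comp_apply, hA, map_mul, map_mul, map_mul, map_inv, map_inv]
  · intro a b
    obtain ⟨f, hf⟩ := hcomm (e a) (e a).2 (e b) (e b).2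
    refine ⟨f, e.injective (Subtype.ext ?_)⟩
    rw [hβ, hf]
    simp

theorem IsPGL.isExtensionOfPSL {X : Type*} {G : Subgroup (Equiv.Perm X)} (h : IsPGL d K G) :
    IsExtensionOfPSL d K G := by
  have hr : ∀ {Y : Type _} (α : ((Fin d → K) ≃ₗ[K] (Fin d → K)) →* Equiv.Perm Y),
      ∀ σ ∈ α.range, ∀ τ ∈ α.range, σ * τ * σ⁻¹ * τ⁻¹ ∈ α.range := fun α σ hσ τ hτ =>
    mul_mem (mul_mem (mul_mem hσ hτ) (inv_mem hσ)) (inv_mem hτ)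
  rcases h with h | h
  · rw [pointsHom_range] at h
    exact isExtensionOfPSL_of_permIso h _ pointsHom_eq_one_iff le_rfl (hr _)
  · rw [pglHyperplanes_eq_range] at h
    exact isExtensionOfPSL_of_permIso h _ hyperplanesHom_eq_one_iff le_rfl (hr _)

theorem IsPGammaL.isExtensionOfPSL [Finite K] {X : Type*} {G : Subgroup (Equiv.Perm X)}
    (h : IsPGammaL d K G) : IsExtensionOfPSL d K G := by
  rcases h with h | h
  · exact isExtensionOfPSL_of_permIso h _ pointsHom_eq_one_iff (pointsHom_range_le d K)
      fun σ hσ τ hτ => commutator_mem_pointsHom_range hσ hτ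
  · exact isExtensionOfPSL_of_permIso h _ hyperplanesHom_eq_one_iff (hyperplanesHom_range_le d K)
      fun σ hσ τ hτ => commutator_mem_hyperplanesHom_range hσ hτ

theorem card_points [Finite K] :
    Nat.card (ℙ K (Fin d → K)) = ∑ i ∈ Finset.range d, Nat.card K ^ i :=
  Projectivization.card_of_finrank K _ (by simp)

/-- Hyperplanes are the points of the projective space of the dual space. -/
theorem card_hyperplanes [Finite K] :
    Nat.card (Hyperplane K (Fin d → K)) = ∑ i ∈ Finset.range d, Nat.card K ^ i := by
  let e := Subspace.orderIsoFiniteDimensional (K := K) (V := Fin d → K)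
  have h1 : ∀ W : Submodule K (Fin d → K), IsCoatom W ↔
      Module.finrank K
        (OrderDual.ofDual (e W) : Submodule K (Module.Dual K (Fin d → K))) = 1 := fun W => by
    rw [← Submodule.isAtom_iff_finrank_eq_one, ← e.isCoatom_iff W]
    exact isAtom_dual_iff_isCoatom.symm
  rw [← Projectivization.card_of_finrank K (Module.Dual K (Fin d → K)) (n := d)
    (by rw [Subspace.dual_finrank_eq]; simp)]
  exact Nat.card_congr (((e.toEquiv.trans OrderDual.ofDual).subtypeEquiv h1).trans
    (Projectivization.equivSubmodule K _).symm)

theorem IsPGL.card_eq [Finite K] {X : Type*} {G : Subgroup (Equiv.Perm X)} (h : IsPGL d K G) :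
    Nat.card X = ∑ i ∈ Finset.range d, Nat.card K ^ i := by
  rcases h with h | h
  · exact h.card_eq.trans card_points
  · exact h.card_eq.trans card_hyperplanes

theorem IsPGammaL.card_eq [Finite K] {X : Type*} {G : Subgroup (Equiv.Perm X)}
    (h : IsPGammaL d K G) : Nat.card X = ∑ i ∈ Finset.range d, Nat.card K ^ i := by
  rcases h with h | h
  · exact h.card_eq.trans card_points
  · exact h.card_eq.trans card_hyperplanes

end LinearModel

/-! ### Linear groups with a large prime divisor of the order -/

section PrimeDegree

theorem notMem_center_of_apply_ne_zero {n : Type*} [Fintype n] [DecidableEq n] {K : Type*}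
    [Field K] {A : Matrix.SpecialLinearGroup n K} {i j : n} (hij : i ≠ j) (h : A.1 i j ≠ 0) :
    A ∉ Subgroup.center (Matrix.SpecialLinearGroup n K) := by
  intro hA
  obtain ⟨c, -, hc⟩ := Matrix.SpecialLinearGroup.mem_center_iff.1 hA
  exact h (by rw [← hc]; simp [hij])

/-- A generator `x` of the unit group satisfies `x ^ 2 ≠ 1` if there are at least four scalars. -/
theorem specialLinearGroup_two_perfect {K : Type*} [Field K] (hK : 4 ≤ Nat.card K) :
    commutator SL(2, K) = ⊤ := by
  have : Finite K := (Nat.card_pos_iff.1 (by omega)).2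
  obtain ⟨x, hx⟩ : IsCyclic Kˣ := inferInstance
  refine Matrix.SL2.commutator_eq_top x.ne_zero fun h => ?_
  rw [Nat.card_eq_card_units_add_one K, ← orderOf_eq_card_of_forall_mem_zpowers hx] at hK
  have := orderOf_le_of_pow_eq_one zero_lt_two (Units.ext (by simpa using h) : x ^ 2 = 1)
  omega

/-- A homomorphism from `SL_2(K)` with a noncentral element in its kernel is trivial, because
`SL_2(K)` is perfect and simple modulo its center. -/
theorem specialLinearGroup_two_eq_one {K : Type*} [Field K] (hK : 4 ≤ Nat.card K) {H : Type*}
    [Group H] (f : SL(2, K) →* H) {x : SL(2, K)} (hx : x ∉ Subgroup.center SL(2, K))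
    (hfx : f x = 1) : f = 1 := by
  have hsimple := Matrix.ProjectiveSpecialLinearGroup.rank_two_simple hK
  have hperf : commutator SL(2, K) = ⊤ := specialLinearGroup_two_perfect hK
  have hcenter : ∀ g, ∃ z ∈ Subgroup.center SL(2, K), f g = f z := by
    intro g
    have hmap : f.ker.map (QuotientGroup.mk' (Subgroup.center SL(2, K))) = ⊤ := by
      have hn : (f.ker.map (QuotientGroup.mk' (Subgroup.center SL(2, K)))).Normal :=
        f.normal_ker.map _ (QuotientGroup.mk'_surjective _)
      refine (hsimple.eq_bot_or_eq_top_of_normal _ hn).resolve_left fun h => hx ?_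
      have h1 : QuotientGroup.mk' (Subgroup.center SL(2, K)) x ∈ f.ker.map
        (QuotientGroup.mk' (Subgroup.center SL(2, K))) := Subgroup.mem_map_of_mem _ hfx
      rw [h] at h1
      exact (QuotientGroup.eq_one_iff x).1 h1
    obtain ⟨n, hn, hng⟩ : QuotientGroup.mk' (Subgroup.center SL(2, K)) g ∈ f.ker.map
      (QuotientGroup.mk' (Subgroup.center SL(2, K))) := hmap ▸ Subgroup.mem_top _
    refine ⟨n⁻¹ * g, QuotientGroup.eq.1 hng, ?_⟩
    rw [map_mul, map_inv, (MonoidHom.mem_ker).1 hn, inv_one, one_mul]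
  have hle : commutator SL(2, K) ≤ f.ker := by
    rw [commutator_def, Subgroup.commutator_le]
    intro a _ b _
    rw [MonoidHom.mem_ker, map_commutatorElement, commutatorElement_eq_one_iff_mul_comm]
    obtain ⟨z, hz, hza⟩ := hcenter a
    rw [hza, ← map_mul, ← map_mul, Subgroup.mem_center_iff.1 hz b]
  rw [hperf, top_le_iff] at hle
  exact MonoidHom.ker_eq_top_iff.1 hle

theorem IsExtensionOfPSL.not_isKSolvable {d : ℕ} {K : Type*} [Field K] {G : Type*} [Group G]
    (hG : IsExtensionOfPSL d K G) {k : ℕ} (hd : 2 ≤ d) (hperf : commutator SL(d, K) = ⊤)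
    (hk : ∀ f : SL(d, K) →* Equiv.Perm (Fin k), f = 1) : ¬ IsKSolvable k G := by
  intro h
  obtain ⟨φ, P, hφ, -⟩ := hG
  have h01 : (⟨0, by omega⟩ : Fin d) ≠ ⟨1, by omega⟩ := by simp
  have h1 : Matrix.SpecialLinearGroup.transvection h01 (1 : K) ∈ φ.ker := by
    rw [eq_one_of_isKSolvable h hperf hk φ]; rfl
  rw [hφ, Matrix.SpecialLinearGroup.transvection_mem_center_iff] at h1
  exact one_ne_zero h1

/-- Transvections in `SL_2(p)` have order `p`. -/
theorem specialLinearGroup_two_prime_hom_eq_one {p : ℕ} [Fact p.Prime] (hp : 5 ≤ p) {k : ℕ}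
    (hk : k < p) (f : SL(2, ZMod p) →* Equiv.Perm (Fin k)) : f = 1 := by
  have h01 : (0 : Fin 2) ≠ 1 := by simp
  have hpow : ∀ n : ℕ, Matrix.SpecialLinearGroup.transvection h01 (1 : ZMod p) ^ n =
      Matrix.SpecialLinearGroup.transvection h01 (n : ZMod p) := by
    intro n
    induction n with
    | zero => simp
    | succ n ih => rw [pow_succ, ih, ← Matrix.SpecialLinearGroup.transvection_add]; simp
  refine specialLinearGroup_two_eq_one (by simp; omega) f
    (x := Matrix.SpecialLinearGroup.transvection h01 1) ?_ ?_
  · rw [Matrix.SpecialLinearGroup.transvection_mem_center_iff]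
    exact one_ne_zero
  · refine perm_fin_eq_one_of_pow_prime (Fact.out : p.Prime) hk ?_
    rw [← map_pow, hpow]
    simp

theorem IsPGL.le_of_isKSolvable_two {p : ℕ} [Fact p.Prime] (hp : 5 ≤ p) {X : Type*}
    {G : Subgroup (Equiv.Perm X)} (hG : IsPGL 2 (ZMod p) G) {k : ℕ} (h : IsKSolvable k G) :
    p ≤ k := by
  by_contra! hk
  exact hG.isExtensionOfPSL.not_isKSolvable le_rfl (specialLinearGroup_two_perfect (by simp; omega))
    (specialLinearGroup_two_prime_hom_eq_one hp hk) h

theorem IsPSLTwoEleven.card_eq {X : Type*} {G : Subgroup (Equiv.Perm X)} (hG : IsPSLTwoEleven G) :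
    Nat.card X = 11 := by
  obtain ⟨H, hH, h⟩ := hG
  exact h.card_eq.trans hH

instance factPrimeEleven : Fact (Nat.Prime 11) := ⟨by norm_num⟩

/-- If the only homomorphism from `T` to `G` is trivial, `G` is not the group of permutations of
the cosets of a proper subgroup of a quotient of `T`. -/
theorem eq_top_of_forall_hom_eq_one {T Q G : Type*} [Group T] [Group Q] [Group G] {q : T →* Q}
    (hq : Function.Surjective q) {H : Subgroup Q} (e : G ≃* (MulAction.toPermHom Q (Q ⧸ H)).range)
    (hT : ∀ φ : T →* G, φ = 1) : H = ⊤ := by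
  have h2 : ∀ g, MulAction.toPermHom Q (Q ⧸ H) g = 1 := by
    intro g
    obtain ⟨g, rfl⟩ := hq g
    have h3 : e.symm ((MulAction.toPermHom Q (Q ⧸ H)).rangeRestrict (q g)) = 1 :=
      DFunLike.congr_fun
        (hT (e.symm.toMonoidHom.comp ((MulAction.toPermHom Q (Q ⧸ H)).rangeRestrict.comp q))) g
    rw [e.symm.map_eq_one_iff] at h3
    exact congrArg Subtype.val h3
  rw [eq_top_iff]
  intro g _
  have h5 : g • ((1 : Q) : Q ⧸ H) = (1 : Q) :=
    DFunLike.congr_fun (h2 g) ((1 : Q) : Q ⧸ H)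
  rw [MulAction.Quotient.smul_coe, eq_comm, QuotientGroup.eq] at h5
  simpa using h5

theorem IsPSLTwoEleven.le_of_isKSolvable {X : Type*} {G : Subgroup (Equiv.Perm X)}
    (hG : IsPSLTwoEleven G) {k : ℕ} (h : IsKSolvable k G) : 11 ≤ k := by
  by_contra! hk
  obtain ⟨H, hH, hGH⟩ := hG
  obtain ⟨e⟩ := hGH.mulEquiv
  have h4 := eq_top_of_forall_hom_eq_one
    (QuotientGroup.mk'_surjective (Subgroup.center SL(2, ZMod 11))) e
    (eq_one_of_isKSolvable h (specialLinearGroup_two_perfect (by rw [Nat.card_zmod]; norm_num))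
      (specialLinearGroup_two_prime_hom_eq_one (by norm_num) hk))
  rw [h4, Subgroup.index_top] at hH
  norm_num at hH

/-- The lower bound for a copy of `PSL_d(K)` that contains two elements of order `p` as in
`eq_one_of_isKSolvable_of_pow`; an entry off the diagonal witnesses that the first of them is not
central. -/
theorem IsExtensionOfPSL.le_of_isKSolvable {d p : ℕ} {K : Type*} [Field K] {G : Type*} [Group G]
    (hG : IsExtensionOfPSL d K G) {k : ℕ} (h : IsKSolvable k G) {a b : ℕ} (hp : p.Prime)
    (x y : SL(d, K)) {i j : Fin d} (hij : i ≠ j) (hxij : x.1 i j ≠ 0) (hx : x ^ p = 1)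
    (hy : y ^ p = 1) (hxy : (x * y) ^ a = 1) (hxyy : (x * y ^ 2) ^ b = 1) (ha : p.Coprime a)
    (hb : p.Coprime b) : p ≤ k := by
  by_contra! hk
  obtain ⟨φ, P, hφ, -⟩ := hG
  refine notMem_center_of_apply_ne_zero hij hxij ?_
  rw [← hφ]
  exact eq_one_of_isKSolvable_of_pow h φ hp hk hx hy hxy hxyy ha hb

theorem IsPGL.seven_le_of_isKSolvable {X : Type*} {G : Subgroup (Equiv.Perm X)}
    (hG : IsPGL 3 (ZMod 2) G) {k : ℕ} (h : IsKSolvable k G) : 7 ≤ k :=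
  hG.isExtensionOfPSL.le_of_isKSolvable h (p := 7) (a := 4) (b := 3) (by norm_num)
    ⟨!![0, 0, 1; 1, 0, 0; 0, 1, 1], by decide +kernel⟩
    ⟨!![0, 0, 1; 1, 0, 1; 0, 1, 0], by decide +kernel⟩
    (show (1 : Fin 3) ≠ 0 by decide) (by decide +kernel) (by decide +kernel) (by decide +kernel)
    (by decide +kernel) (by decide +kernel) (by norm_num) (by norm_num)

theorem IsPGL.thirteen_le_of_isKSolvable {X : Type*} {G : Subgroup (Equiv.Perm X)}
    (hG : IsPGL 3 (ZMod 3) G) {k : ℕ} (h : IsKSolvable k G) : 13 ≤ k :=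
  hG.isExtensionOfPSL.le_of_isKSolvable h (p := 13) (a := 4) (b := 6) (by norm_num)
    ⟨!![0, 0, 1; 1, 0, 0; 0, 1, 2], by decide +kernel⟩
    ⟨!![0, 0, 1; 1, 0, 1; 0, 1, 0], by decide +kernel⟩
    (show (1 : Fin 3) ≠ 0 by decide) (by decide +kernel) (by decide +kernel) (by decide +kernel)
    (by decide +kernel) (by decide +kernel) (by norm_num) (by norm_num)

theorem IsPGL.thirtyOne_le_of_isKSolvable {X : Type*} {G : Subgroup (Equiv.Perm X)}
    (hG : IsPGL 5 (ZMod 2) G) {k : ℕ} (h : IsKSolvable k G) : 31 ≤ k :=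
  hG.isExtensionOfPSL.le_of_isKSolvable h (p := 31) (a := 8) (b := 15) (by norm_num)
    ⟨!![0, 0, 0, 0, 1; 1, 0, 0, 0, 0; 0, 1, 0, 0, 0; 0, 0, 1, 0, 1; 0, 0, 0, 1, 0],
      by decide +kernel⟩
    ⟨!![0, 0, 0, 0, 1; 1, 0, 0, 0, 0; 0, 1, 0, 0, 1; 0, 0, 1, 0, 0; 0, 0, 0, 1, 0],
      by decide +kernel⟩
    (show (1 : Fin 5) ≠ 0 by decide) (by decide +kernel) (by decide +kernel) (by decide +kernel)
    (by decide +kernel) (by decide +kernel) (by norm_num) (by norm_num)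

end PrimeDegree

/-! ### Transvections in dimension at least three -/

section Transvection

open Matrix.SpecialLinearGroup

variable {n : Type*} [Fintype n] [DecidableEq n] {K : Type*} [Field K]

theorem transvection_mulVec {i j : n} (hij : i ≠ j) (b : K) (v : n → K) :
    (transvection hij b).1.mulVec v = v + Pi.single i (b * v j) := by
  rw [transvection_coe, Matrix.add_mulVec, Matrix.one_mulVec, Matrix.single_mulVec_eq]
  ext p
  by_cases hp : p = i
  · subst hp; simp
  · simp [hp]

theorem specialLinearGroup_ext {A B : Matrix.SpecialLinearGroup n K}
    (h : ∀ v, A.1.mulVec v = B.1.mulVec v) : A = B :=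
  Subtype.ext (Matrix.ext_of_mulVec_single fun _ => h _)

/-- The commutator of `E_ij(a)` and `E_jk(b)` is `E_ik(a * b)`. -/
theorem transvection_mul_transvection {i j k : n} (hij : i ≠ j) (hjk : j ≠ k) (hik : i ≠ k)
    (a b : K) : transvection hij a * transvection hjk b =
      transvection hik (a * b) * (transvection hjk b * transvection hij a) := by
  refine specialLinearGroup_ext fun v => ?_
  simp only [coe_mul, ← Matrix.mulVec_mulVec, transvection_mulVec]
  simp [hjk.symm, hik.symm, mul_add, Pi.single_add, add_assoc,
    add_left_comm, mul_assoc]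

/-- The diagonal matrix with entries `a` and `a⁻¹` as a product of transvections. -/
theorem diag2n_eq {i j : n} (hij : i ≠ j) {a : K} (ha : a ≠ 0) :
    diag2n hij a ha = transvection hij a * transvection hij.symm (-a⁻¹) * transvection hij a *
      transvection hij (-1) * transvection hij.symm 1 * transvection hij (-1) := by
  refine specialLinearGroup_ext fun v => ?_
  simp only [coe_mul, ← Matrix.mulVec_mulVec, transvection_mulVec, diag2n_coe]
  ext p
  rw [Matrix.mulVec_diagonal]
  by_cases hp : p = i
  · subst hp
    simp [hij, hij.symm]
    field_simp
    ring
  · by_cases hq : p = j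
    · subst hq
      simp [hp, Ne.symm hp]
      field_simp
      ring
    · simp [hp, hq]

/-- The transvections generate the special linear group. -/
theorem specialLinearGroup_eq_top_of_transvection_mem [Nontrivial n]
    {N : Subgroup (Matrix.SpecialLinearGroup n K)}
    (h : ∀ (i j : n) (hij : i ≠ j) (a : K), transvection hij a ∈ N) : N = ⊤ := by
  rw [eq_top_iff]
  intro A _
  refine diagonal_transvection_induction' (fun A => A ∈ N) A (fun i j hij c hc => ?_) h
    fun A B hA hB => mul_mem hA hB
  rw [diag2n_eq]
  exact mul_mem (mul_mem (mul_mem (mul_mem (mul_mem (h _ _ _ _) (h _ _ _ _)) (h _ _ _ _))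
    (h _ _ _ _)) (h _ _ _ _)) (h _ _ _ _)

/-- In dimension at least three every transvection is a commutator of transvections. -/
theorem commutator_specialLinearGroup_eq_top (hn : 3 ≤ Fintype.card n) :
    commutator (Matrix.SpecialLinearGroup n K) = ⊤ := by
  have : Nontrivial n := Fintype.one_lt_card_iff_nontrivial.1 (by omega)
  refine specialLinearGroup_eq_top_of_transvection_mem fun i k hik a => ?_
  obtain ⟨j, hji, hjk⟩ : ∃ j, j ≠ i ∧ j ≠ k := by
    obtain ⟨j, hj⟩ := Finset.exists_mem_notMem_of_card_lt_card
      (s := {i, k}) (t := Finset.univ)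
      (lt_of_le_of_lt Finset.card_le_two (by rw [Finset.card_univ]; omega))
    exact ⟨j, by simpa using hj⟩
  have h1 := transvection_mul_transvection hji.symm hjk hik a 1
  rw [mul_one, ← mul_inv_eq_iff_eq_mul, mul_inv_rev, ← mul_assoc] at h1
  rw [← h1]
  exact Subgroup.commutator_mem_commutator (Subgroup.mem_top _) (Subgroup.mem_top _)

/-- In dimension at least three, a normal subgroup of `SL_n(K)` containing one elementary
transvection is everything. -/
theorem normal_eq_top_of_transvection_mem (hn : 3 ≤ Fintype.card n)
    {N : Subgroup (Matrix.SpecialLinearGroup n K)} (hN : N.Normal) {i₀ j₀ : n} (h₀ : i₀ ≠ j₀)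
    {c : K} (hc : c ≠ 0) (hmem : transvection h₀ c ∈ N) : N = ⊤ := by
  have : Nontrivial n := ⟨i₀, j₀, h₀⟩
  have hthird : ∀ i j : n, ∃ k, k ≠ i ∧ k ≠ j := by
    intro i j
    obtain ⟨k, hk⟩ := Finset.exists_mem_notMem_of_card_lt_card
      (s := {i, j}) (t := Finset.univ)
      (lt_of_le_of_lt Finset.card_le_two (by rw [Finset.card_univ]; omega))
    exact ⟨k, by simpa using hk⟩
  have hright : ∀ {i j k : n} (hij : i ≠ j) (hjk : j ≠ k) (hik : i ≠ k) (a b : K),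
      transvection hij a ∈ N → transvection hik (a * b) ∈ N := by
    intro i j k hij hjk hik a b h
    have h1 := transvection_mul_transvection hij hjk hik a b
    rw [← mul_assoc, ← mul_inv_eq_iff_eq_mul, ← eq_mul_inv_iff_mul_eq] at h1
    have h2 := mul_mem h (hN.conj_mem _ (inv_mem h) (transvection hjk b))
    rwa [show transvection hik (a * b) = transvection hij a *
      (transvection hjk b * (transvection hij a)⁻¹ * (transvection hjk b)⁻¹) by
        rw [eq_comm, ← mul_assoc, ← mul_assoc, h1]; group]
  have hleft : ∀ {i j k : n} (hij : i ≠ j) (hki : k ≠ i) (hkj : k ≠ j) (a b : K),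
      transvection hij a ∈ N → transvection hkj (b * a) ∈ N := by
    intro i j k hij hki hkj a b h
    have h1 := transvection_mul_transvection hki hij hkj b a
    have h2 := mul_mem (hN.conj_mem _ h (transvection hki b)) (inv_mem h)
    rwa [h1, show transvection hkj (b * a) * (transvection hij a * transvection hki b) *
      (transvection hki b)⁻¹ * (transvection hij a)⁻¹ = transvection hkj (b * a) by group] at h2
  have hright' : ∀ i j k : n, i ≠ j → i ≠ k → (∀ hij : i ≠ j, ∀ b : K, transvection hij b ∈ N) →
      ∀ hik : i ≠ k, ∀ b : K, transvection hik b ∈ N := by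
    intro i j k hij hik h _ b
    by_cases hjk : j = k
    · subst hjk; exact h hik b
    · simpa using hright hij hjk hik 1 b (h hij 1)
  have hleft' : ∀ i j k : n, i ≠ j → k ≠ j → (∀ hij : i ≠ j, ∀ b : K, transvection hij b ∈ N) →
      ∀ hkj : k ≠ j, ∀ b : K, transvection hkj b ∈ N := by
    intro i j k hij hkj h _ b
    by_cases hki : k = i
    · subst hki; exact h hij b
    · simpa using hleft hij hki hkj 1 b (h hij 1)
  obtain ⟨r, hri, hrj⟩ := hthird i₀ j₀
  have h1 : ∀ h : i₀ ≠ r, ∀ b : K, transvection h b ∈ N := fun h b => by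
    simpa [mul_div_cancel₀ _ hc] using hright h₀ hrj.symm h c (b / c) hmem
  refine specialLinearGroup_eq_top_of_transvection_mem fun p q hpq => ?_
  by_cases hp : p = r
  · subst hp
    have h2 := hright' _ _ j₀ hri.symm h₀ h1
    exact hright' _ _ q hrj hpq (hleft' _ _ p h₀ hrj h2) hpq
  · exact hright' _ _ q hp hpq (hleft' _ _ p hri.symm hp h1) hpq

theorem specialLinearGroup_hom_eq_one (hn : 3 ≤ Fintype.card n) {H : Type*} [Group H]
    (f : Matrix.SpecialLinearGroup n K →* H) {i j : n} (hij : i ≠ j) {c : K} (hc : c ≠ 0)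
    (h : f (transvection hij c) = 1) : f = 1 :=
  MonoidHom.ker_eq_top_iff.1 (normal_eq_top_of_transvection_mem hn f.normal_ker hij hc h)

end Transvection

/-! ### Counting fixed points of unipotent elements -/

section FixedPoints

open Matrix.SpecialLinearGroup

/-- The number of elements fixed by a permutation of `Fin k`. -/
def fixCard {k : ℕ} (σ : Equiv.Perm (Fin k)) : ℕ := (Finset.univ.filter fun i => σ i = i).card

theorem fixCard_le {k : ℕ} (σ : Equiv.Perm (Fin k)) : fixCard σ ≤ k :=
  (Finset.card_le_univ _).trans_eq (Fintype.card_fin k)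

theorem fixCard_one (k : ℕ) : fixCard (1 : Equiv.Perm (Fin k)) = k := by
  simp [fixCard]

theorem fixCard_eq_iff {k : ℕ} (σ : Equiv.Perm (Fin k)) : fixCard σ = k ↔ σ = 1 := by
  constructor
  · intro h
    have h1 : (Finset.univ.filter fun i => σ i = i) = Finset.univ :=
      Finset.eq_univ_of_card _ (by rw [Fintype.card_fin]; exact h)
    ext i
    have h2 : i ∈ Finset.univ.filter fun i => σ i = i := by
      rw [h1]; exact Finset.mem_univ i
    simpa using congrArg Fin.val (Finset.mem_filter.1 h2).2
  · rintro rfl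
    exact fixCard_one k

theorem fixCard_conj {k : ℕ} (σ τ : Equiv.Perm (Fin k)) :
    fixCard (τ * σ * τ⁻¹) = fixCard σ := by
  refine (Finset.card_bij (fun i _ => τ i) ?_ ?_ ?_).symm
  · intro i hi
    rw [Finset.mem_filter] at hi ⊢
    exact ⟨Finset.mem_univ _, by simpa using hi.2⟩
  · intro i _ j _ h
    exact τ.injective h
  · intro j hj
    refine ⟨τ⁻¹ j, ?_, by simp⟩
    rw [Finset.mem_filter] at hj ⊢
    exact ⟨Finset.mem_univ _, by rw [Equiv.Perm.eq_inv_iff_eq]; exact hj.2⟩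

theorem fixCard_map_eq_of_mul_eq {T : Type*} [Group T] {k : ℕ} (f : T →* Equiv.Perm (Fin k))
    {g x y : T} (h : g * x = y * g) : fixCard (f x) = fixCard (f y) := by
  rw [← mul_inv_eq_iff_eq_mul] at h
  rw [← h, map_mul, map_mul, map_inv, fixCard_conj]

theorem fixCard_modEq {k p : ℕ} [Fact p.Prime] {σ : Equiv.Perm (Fin k)} (h : σ ^ p = 1) :
    fixCard σ ≡ k [MOD p] := by
  let f : Function.End (Fin k) := MulAction.toEndHom σ
  have hf : f ^ p ^ 1 = 1 := by rw [pow_one, ← map_pow, h, map_one]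
  let _ : Fintype f.fixedPoints := Subtype.fintype fun i => σ i = i
  have h1 := Equiv.Perm.card_fixedPoints_modEq hf
  rw [Fintype.card_fin] at h1
  have h2 : fixCard σ = Fintype.card f.fixedPoints := (Fintype.card_subtype _).symm
  rw [h2]
  exact h1.symm

/-- **Burnside's lemma** modulo the group order: the numbers of fixed points of the elements of a
group acting on `Fin k` add up to a multiple of the order of the group. -/
theorem card_dvd_sum_fixCard {V : Type*} [Group V] [Fintype V] {k : ℕ}
    (f : V →* Equiv.Perm (Fin k)) : Fintype.card V ∣ ∑ v, fixCard (f v) := by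
  classical
  let _ := MulAction.compHom (Fin k) f
  have h := MulAction.sum_card_fixedBy_eq_card_orbits_mul_card_group V (Fin k)
  have h1 : ∑ v : V, fixCard (f v) = ∑ v : V, Fintype.card (MulAction.fixedBy (Fin k) v) :=
    Finset.sum_congr rfl fun v _ => (Fintype.card_subtype _).symm
  rw [h1, h]
  exact dvd_mul_left _ _

/-- If all nontrivial elements of a finite group `V` act on `k` elements with equally many fixed
points, the number of moved points is a multiple of the order of `V`. -/
theorem card_dvd_sub_fixCard {V : Type*} [Group V] [Fintype V] {k a : ℕ}
    (f : V →* Equiv.Perm (Fin k)) (h : ∀ v ≠ 1, fixCard (f v) = a) (ha : a ≤ k) :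
    Fintype.card V ∣ k - a := by
  classical
  have h1 := card_dvd_sum_fixCard f
  rw [← Finset.add_sum_erase _ _ (Finset.mem_univ (1 : V)), map_one, fixCard_one,
    Finset.sum_congr rfl fun v hv => h v (Finset.ne_of_mem_erase hv), Finset.sum_const,
    Finset.card_erase_of_mem (Finset.mem_univ _), Finset.card_univ, smul_eq_mul] at h1
  have h2 : k + (Fintype.card V - 1) * a = (k - a) + Fintype.card V * a := by
    obtain ⟨c, hc⟩ : ∃ c, Fintype.card V = c + 1 := ⟨Fintype.card V - 1, by
      have : 0 < Fintype.card V := Fintype.card_pos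
      omega⟩
    rw [hc, Nat.add_sub_cancel, add_mul, one_mul]
    omega
  rw [h2] at h1
  exact (Nat.dvd_add_left (dvd_mul_right _ _)).1 h1

/-- The root subgroup of the entry `(i, j)`. -/
def rootHom {n : Type*} [Fintype n] [DecidableEq n] {K : Type*} [Field K] {i j : n} (hij : i ≠ j) :
    Multiplicative K →* Matrix.SpecialLinearGroup n K where
  toFun a := transvection (F := K) hij a.toAdd
  map_one' := transvection_coeff_zero (F := K) hij
  map_mul' a b := transvection_add (F := K) hij a.toAdd b.toAdd

end FixedPoints

/-! ### Permutation representations of `SL_2(9)`, `SL_2(8)` and `SL_4(2)` -/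

section DegreeBounds

open Matrix.SpecialLinearGroup

/-- A faithful action of the root subgroup is impossible, since `9` does not divide `5!`. -/
theorem specialLinearGroup_two_nine_hom_eq_one {K : Type*} [Field K] (hK : Nat.card K = 9) {k : ℕ}
    (hk : k < 6) (f : SL(2, K) →* Equiv.Perm (Fin k)) : f = 1 := by
  have : Finite K := (Nat.card_pos_iff.1 (by omega)).2
  have : Fintype K := Fintype.ofFinite K
  by_cases hinj : Function.Injective (f.comp (rootHom (zero_ne_one : (0 : Fin 2) ≠ 1)))
  · have h1 := Subgroup.card_subgroup_dvd_card
      (f.comp (rootHom (zero_ne_one : (0 : Fin 2) ≠ 1))).range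
    rw [← Nat.card_congr (MonoidHom.ofInjective hinj).toEquiv, Nat.card_congr Multiplicative.toAdd,
      hK, Nat.card_perm, Nat.card_fin] at h1
    have h2 : 9 ∣ Nat.factorial 5 := h1.trans (Nat.factorial_dvd_factorial (by omega))
    norm_num [Nat.factorial] at h2
  · rw [injective_iff_map_eq_one] at hinj
    push Not at hinj
    obtain ⟨a, ha, ha'⟩ := hinj
    refine specialLinearGroup_two_eq_one (by omega) f (x := rootHom zero_ne_one a) ?_ ha
    exact fun h => ha' ((transvection_mem_center_iff (F := K) zero_ne_one a.toAdd).1 h)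

/-- For `k < 8`, counting fixed points in the root subgroup shows that it acts trivially. For
`k = 8` it may also act freely; the diagonal elements of order `7` then lead to a contradiction. -/
theorem specialLinearGroup_two_eight_hom_eq_one {K : Type*} [Field K] (hK : Nat.card K = 8) {k : ℕ}
    (hk : k < 9) (f : SL(2, K) →* Equiv.Perm (Fin k)) : f = 1 := by
  have : Finite K := (Nat.card_pos_iff.1 (by omega)).2
  have : Fintype K := Fintype.ofFinite K
  classical
  have hK' : Fintype.card K = 8 := by rwa [← Nat.card_eq_fintype_card]
  have hchar : ringChar K = 2 := FiniteField.even_card_iff_char_two.2 (by rw [hK'])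
  have h2 : (1 : K) + 1 = 0 := by
    have := ringChar.Nat.cast_ringChar (R := K)
    rw [hchar] at this
    rw [one_add_one_eq_two]
    exact_mod_cast this
  have h01 : (0 : Fin 2) ≠ 1 := zero_ne_one
  -- all unipotent elements `≠ 1` are conjugate, since every element of `K` is a square
  have hconj : ∀ a : K, a ≠ 0 →
      fixCard (f (transvection h01 a)) = fixCard (f (transvection h01 1)) := by
    intro a ha
    obtain ⟨t, rfl⟩ := FiniteField.isSquare_of_char_two hchar a
    have ht : t ≠ 0 := left_ne_zero_of_mul ha
    refine (fixCard_map_eq_of_mul_eq f (g := diag2n h01 t ht) (Subtype.ext ?_)).symm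
    ext i j
    fin_cases i <;> fin_cases j <;>
      simp [transvection_coe, diag2n_coe, Matrix.mul_apply, Fin.sum_univ_two, ht]
  have hdvd := card_dvd_sub_fixCard (f.comp (rootHom h01))
    (fun v hv => hconj (Multiplicative.toAdd v) hv) (fixCard_le _)
  rw [Fintype.card_multiplicative, hK'] at hdvd
  have hle := fixCard_le (f (transvection h01 (1 : K)))
  by_cases heq : fixCard (f (transvection h01 (1 : K))) = k
  · refine specialLinearGroup_two_eq_one (by omega) f (x := transvection h01 1) ?_
      ((fixCard_eq_iff _).1 heq)
    rw [transvection_mem_center_iff]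
    exact one_ne_zero
  -- otherwise `k = 8` and the unipotent elements `≠ 1` have no fixed points
  have hle' := Nat.le_of_dvd (by omega) hdvd
  have hfix0 : fixCard (f (transvection h01 (1 : K))) = 0 := by omega
  obtain rfl : k = 8 := by omega
  obtain ⟨t, ht⟩ : ∃ t : K, t ∉ ({0, 1} : Finset K) := by
    obtain ⟨t, -, ht⟩ := Finset.exists_mem_notMem_of_card_lt_card (s := {(0 : K), 1})
      (t := Finset.univ) (lt_of_le_of_lt Finset.card_le_two (by rw [Finset.card_univ]; omega))
    exact ⟨t, ht⟩
  simp only [Finset.mem_insert, Finset.mem_singleton, not_or] at ht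
  obtain ⟨ht0, ht1⟩ := ht
  have ht7 : t ^ 7 = 1 := by
    have := FiniteField.pow_card_sub_one_eq_one t ht0
    rwa [hK'] at this
  let δ : SL(2, K) := diag2n h01 t ht0
  have hδ7 : δ ^ 7 = 1 := by
    refine Subtype.ext ?_
    rw [coe_pow, diag2n_coe, Matrix.diagonal_pow]
    ext i j
    fin_cases i <;> fin_cases j <;> simp [ht7]
  have : Fact (Nat.Prime 7) := ⟨by norm_num⟩
  have hmod := fixCard_modEq (p := 7) (σ := f δ) (by rw [← map_pow, hδ7, map_one])
  have hδle := fixCard_le (f δ)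
  have hcases : fixCard (f δ) = 1 ∨ fixCard (f δ) = 8 := by
    unfold Nat.ModEq at hmod
    omega
  rcases hcases with h | h
  · -- the Weyl element inverts `δ`, hence fixes its only fixed point, but it is unipotent
    exfalso
    obtain ⟨w, hw⟩ : ∃ w : SL(2, K), w.1 = !![0, 1; 1, 0] :=
      ⟨⟨_, by rw [Matrix.det_fin_two_of]; linear_combination -h2⟩, rfl⟩
    obtain ⟨g, hg⟩ : ∃ g : SL(2, K), g.1 = !![1, 0; 1, 1] := ⟨⟨_, by simp⟩, rfl⟩
    have hw0 : fixCard (f w) = 0 := by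
      rw [← hfix0]
      refine (fixCard_map_eq_of_mul_eq f (g := g) (Subtype.ext ?_)).symm
      rw [coe_mul, coe_mul, transvection_coe, hg, hw]
      ext i j
      fin_cases i <;> fin_cases j <;>
        simp [Matrix.mul_apply, Fin.sum_univ_two, h2]
    have hwδ : δ * w * δ = w := by
      refine Subtype.ext ?_
      rw [coe_mul, coe_mul, diag2n_coe, hw]
      ext i j
      fin_cases i <;> fin_cases j <;> simp [Matrix.mul_apply, Fin.sum_univ_two, ht0]
    obtain ⟨p, hp⟩ := Finset.card_eq_one.1 h
    have hmem : ∀ q, f δ q = q ↔ q = p := fun q => by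
      have h3 : q ∈ Finset.univ.filter (fun i => f δ i = i) ↔ q ∈ ({p} : Finset _) := by rw [hp]
      simpa using h3
    have hδp := (hmem p).2 rfl
    have hwp : f w p = p := by
      rw [← hmem]
      have h3 := DFunLike.congr_fun (congrArg f hwδ) p
      rw [map_mul, map_mul, Equiv.Perm.mul_apply, Equiv.Perm.mul_apply, hδp] at h3
      exact h3
    rw [fixCard, Finset.card_eq_zero] at hw0
    have : p ∈ Finset.univ.filter fun i => f w i = i :=
      Finset.mem_filter.2 ⟨Finset.mem_univ _, hwp⟩
    rw [hw0] at this
    simp at this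
  · refine specialLinearGroup_two_eq_one (by omega) f (x := δ) (fun hc => ht1 ?_)
      ((fixCard_eq_iff _).1 h)
    obtain ⟨c, -, hc⟩ := mem_center_iff.1 hc
    have e0 : c = t := by simpa [δ, diag2n_coe] using congrFun (congrFun hc 0) 0
    have e1 : c = t⁻¹ := by simpa [δ, diag2n_coe] using congrFun (congrFun hc 1) 1
    have e2 : t * t = 1 := by rw [← e0]; nth_rewrite 2 [e1]; rw [e0, mul_inv_cancel₀ ht0]
    have e3 : (t - 1) * (t - 1) = 0 := by linear_combination e2 + (1 - t) * h2
    exact sub_eq_zero.1 (mul_self_eq_zero.1 e3)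

/-- The transvections of `F_2^4` with the hyperplane of the first three coordinates as axis. -/
def axisTransvectionHom : Multiplicative (ZMod 2 × ZMod 2 × ZMod 2) →* SL(4, ZMod 2) where
  toFun v := ⟨!![1, 0, 0, v.1; 0, 1, 0, v.2.1; 0, 0, 1, v.2.2; 0, 0, 0, 1], by
    revert v; decide +kernel⟩
  map_one' := Subtype.ext (by decide +kernel)
  map_mul' x y := Subtype.ext (by revert x y; decide +kernel)

/-- A linear automorphism of `F_2^4` that preserves the last coordinate and maps the first basis
vector to `(v, 0)`, for `v ≠ 0`. -/
def axisMatrix (v : ZMod 2 × ZMod 2 × ZMod 2) : Matrix (Fin 4) (Fin 4) (ZMod 2) :=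
  if v.1 = 1 then !![1, 0, 0, 0; v.2.1, 1, 0, 0; v.2.2, 0, 1, 0; 0, 0, 0, 1]
  else if v.2.1 = 1 then !![0, 1, 0, 0; 1, 0, 0, 0; v.2.2, 0, 1, 0; 0, 0, 0, 1]
  else !![0, 0, 1, 0; 0, 1, 0, 0; 1, 0, 0, 0; 0, 0, 0, 1]

theorem det_axisMatrix (v : ZMod 2 × ZMod 2 × ZMod 2) : (axisMatrix v).det = 1 := by
  revert v
  decide +kernel

theorem axisMatrix_mul (v : ZMod 2 × ZMod 2 × ZMod 2) (hv : v ≠ 0) :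
    axisMatrix v * (axisTransvectionHom (.ofAdd (1, 0, 0))).1 =
      (axisTransvectionHom (.ofAdd v)).1 * axisMatrix v := by
  revert v
  decide +kernel

theorem specialLinearGroup_four_two_hom_eq_one {k : ℕ} (hk : k < 8)
    (f : SL(4, ZMod 2) →* Equiv.Perm (Fin k)) : f = 1 := by
  have hdvd := card_dvd_sub_fixCard (f.comp axisTransvectionHom)
    (fun v hv => (fixCard_map_eq_of_mul_eq f (g := ⟨axisMatrix v.toAdd, det_axisMatrix _⟩)
      (Subtype.ext (axisMatrix_mul v.toAdd hv))).symm) (fixCard_le _)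
  have hle := fixCard_le (f (axisTransvectionHom (.ofAdd (1, 0, 0))))
  have hcard : Fintype.card (Multiplicative (ZMod 2 × ZMod 2 × ZMod 2)) = 8 := rfl
  rw [hcard] at hdvd
  have heq : fixCard (f (axisTransvectionHom (.ofAdd (1, 0, 0)))) = k := by omega
  rw [fixCard_eq_iff] at heq
  have h03 : (0 : Fin 4) ≠ 3 := by decide
  refine specialLinearGroup_hom_eq_one (by simp) f h03 one_ne_zero ?_
  rw [← heq]
  have h1 : Matrix.transvection (0 : Fin 4) 3 (1 : ZMod 2) =
      (axisTransvectionHom (.ofAdd (1, 0, 0))).1 := by decide +kernel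
  exact congrArg f (Subtype.ext h1)

end DegreeBounds

/-! ### The group `PΓL_3(4)` -/

section PGammaLThreeFour

/-- The upper unitriangular `3 × 3` matrices over `K`; the matrix with rows `(1, a, b)`,
`(0, 1, c)`, `(0, 0, 1)` is given by its entries `a`, `b`, `c`. -/
@[ext]
structure Heisenberg (K : Type*) where
  /-- The entry above the diagonal in the first row. -/
  a : K
  /-- The corner entry. -/
  b : K
  /-- The entry above the diagonal in the second row. -/
  c : K

namespace Heisenberg

/-- The coordinates of a unitriangular matrix. -/
def coordinates {K : Type*} : K × K × K ≃ Heisenberg K where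
  toFun x := ⟨x.1, x.2.1, x.2.2⟩
  invFun x := (x.a, x.b, x.c)
  left_inv _ := rfl
  right_inv _ := rfl

instance {K : Type*} [Fintype K] : Fintype (Heisenberg K) := Fintype.ofEquiv _ coordinates

theorem card_eq {K : Type*} [Fintype K] : Fintype.card (Heisenberg K) = Fintype.card K ^ 3 := by
  rw [← Fintype.card_congr coordinates, Fintype.card_prod, Fintype.card_prod]
  ring

variable {K : Type*} [Field K]

instance : Mul (Heisenberg K) := ⟨fun x y => ⟨x.a + y.a, x.b + y.b + x.a * y.c, x.c + y.c⟩⟩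

instance : One (Heisenberg K) := ⟨⟨0, 0, 0⟩⟩

instance : Inv (Heisenberg K) := ⟨fun x => ⟨-x.a, x.a * x.c - x.b, -x.c⟩⟩

theorem mul_def (x y : Heisenberg K) :
    x * y = ⟨x.a + y.a, x.b + y.b + x.a * y.c, x.c + y.c⟩ := rfl

theorem one_def : (1 : Heisenberg K) = ⟨0, 0, 0⟩ := rfl

theorem inv_def (x : Heisenberg K) : x⁻¹ = ⟨-x.a, x.a * x.c - x.b, -x.c⟩ := rfl

instance : Group (Heisenberg K) :=
  Group.ofLeftAxioms (fun x y z => by ext <;> simp only [mul_def] <;> ring)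
    (fun x => by ext <;> simp [mul_def, one_def])
    (fun x => by ext <;> simp [mul_def, one_def, inv_def])

/-- A unitriangular matrix as an element of `SL_3(K)`. -/
def toSL : Heisenberg K →* SL(3, K) where
  toFun x := ⟨!![1, x.a, x.b; 0, 1, x.c; 0, 0, 1], by simp [Matrix.det_fin_three]⟩
  map_one' := Subtype.ext (by
    change !![1, 0, 0; 0, 1, 0; 0, 0, 1] = 1
    ext i j
    fin_cases i <;> fin_cases j <;> simp)
  map_mul' x y := Subtype.ext (by
    change !![1, x.a + y.a, x.b + y.b + x.a * y.c; 0, 1, x.c + y.c; 0, 0, 1] =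
      !![1, x.a, x.b; 0, 1, x.c; 0, 0, 1] * !![1, y.a, y.b; 0, 1, y.c; 0, 0, 1]
    ext i j
    fin_cases i <;> fin_cases j <;>
      simp [Matrix.mul_apply, Fin.sum_univ_three] <;> ring)

theorem coe_toSL (x : Heisenberg K) :
    (toSL x).1 = !![1, x.a, x.b; 0, 1, x.c; 0, 0, 1] := rfl

/-- The unitriangular matrices with `a = 0`. -/
def columnHom : Multiplicative (K × K) →* Heisenberg K where
  toFun v := ⟨0, v.toAdd.1, v.toAdd.2⟩
  map_one' := rfl
  map_mul' v w := by ext <;> simp [mul_def]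

/-- The unitriangular matrices with `c = 0`. -/
def rowHom : Multiplicative (K × K) →* Heisenberg K where
  toFun v := ⟨v.toAdd.1, v.toAdd.2, 0⟩
  map_one' := rfl
  map_mul' v w := by ext <;> simp [mul_def]

/-- The unitriangular matrices with `a * c = 0` other than `1` are transvections, hence conjugate
in `SL_3(K)`. -/
theorem exists_toSL_mul_eq_of_mul_eq_zero (x : Heisenberg K) (hx : x ≠ 1) (h : x.a * x.c = 0) :
    ∃ g : SL(3, K), g * toSL ⟨0, 1, 0⟩ = toSL x * g := by
  obtain ⟨a, b, c⟩ := x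
  suffices h1 : ∃ g : Matrix (Fin 3) (Fin 3) K, g.det = 1 ∧
      g * !![1, 0, 1; 0, 1, 0; 0, 0, 1] = !![1, a, b; 0, 1, c; 0, 0, 1] * g by
    obtain ⟨g, hg, hg'⟩ := h1
    exact ⟨⟨g, hg⟩, Subtype.ext hg'⟩
  by_cases hb : b = 0
  · subst hb
    rcases mul_eq_zero.1 h with rfl | rfl
    · have hc : c ≠ 0 := by
        rintro rfl
        exact hx rfl
      refine ⟨!![0, -c⁻¹, 0; c, 0, 0; 0, 0, 1], by simp [Matrix.det_fin_three, hc], ?_⟩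
      ext i j
      fin_cases i <;> fin_cases j <;> simp [Matrix.mul_apply, Fin.sum_univ_three]
    · have ha : a ≠ 0 := by
        rintro rfl
        exact hx rfl
      refine ⟨!![1, 0, 0; 0, 0, a⁻¹; 0, -a, 0], by simp [Matrix.det_fin_three, ha], ?_⟩
      ext i j
      fin_cases i <;> fin_cases j <;> simp [Matrix.mul_apply, Fin.sum_univ_three, ha]
  · rcases mul_eq_zero.1 h with rfl | rfl
    · refine ⟨!![b, 0, 0; c, b⁻¹, 0; 0, 0, 1], by simp [Matrix.det_fin_three, hb], ?_⟩
      ext i j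
      fin_cases i <;> fin_cases j <;> simp [Matrix.mul_apply, Fin.sum_univ_three]
    · refine ⟨!![1, 0, 0; 0, b, 0; 0, -a, b⁻¹], by simp [Matrix.det_fin_three, hb], ?_⟩
      ext i j
      fin_cases i <;> fin_cases j <;> simp [Matrix.mul_apply, Fin.sum_univ_three, hb, mul_comm]

/-- A unitriangular matrix with `a ≠ 0` is conjugate to one with `a = 1`, `b = 0` and the same
quotient `c / a`. -/
theorem exists_toSL_mul_eq_of_ne_zero (x : Heisenberg K) (h : x.a ≠ 0) :
    ∃ g : SL(3, K), g * toSL ⟨1, 0, x.c / x.a⟩ = toSL x * g := by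
  obtain ⟨a, b, c⟩ := x
  have ha : a ≠ 0 := h
  refine ⟨⟨!![a, 0, 0; 0, 1, -b / a ^ 2; 0, 0, a⁻¹], by simp [Matrix.det_fin_three, ha]⟩,
    Subtype.ext ?_⟩
  change !![a, 0, 0; 0, 1, -b / a ^ 2; 0, 0, a⁻¹] * !![1, 1, 0; 0, 1, c / a; 0, 0, 1] =
    !![1, a, b; 0, 1, c; 0, 0, 1] * !![a, 0, 0; 0, 1, -b / a ^ 2; 0, 0, a⁻¹]
  ext i j
  fin_cases i <;> fin_cases j <;> simp [Matrix.mul_apply, Fin.sum_univ_three] <;> field_simp <;>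
    ring

/-- A subgroup all of whose elements satisfy `a * c = 0` lies in one of the two maximal abelian
subgroups `a = 0` and `c = 0`. -/
theorem forall_eq_zero_or_forall_eq_zero (H : Subgroup (Heisenberg K))
    (hH : ∀ x ∈ H, x.a * x.c = 0) : (∀ x ∈ H, x.a = 0) ∨ ∀ x ∈ H, x.c = 0 := by
  by_contra! h
  obtain ⟨⟨x, hx, hxa⟩, y, hy, hyc⟩ := h
  have hxc := (mul_eq_zero.1 (hH x hx)).resolve_left hxa
  have hya := (mul_eq_zero.1 (hH y hy)).resolve_right hyc
  have h1 := hH _ (mul_mem hx hy)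
  simp only [mul_def, hxc, hya, add_zero, zero_add] at h1
  exact (mul_ne_zero hxa hyc) h1

/-- The sum of a function over the unitriangular matrices that is constant on the transvections
and, outside of the two maximal abelian subgroups, depends only on the quotient `c / a`. -/
theorem sum_eq [Fintype K] [DecidableEq K] (F : Heisenberg K → ℕ) (α : ℕ) (s : K → ℕ)
    (hα : ∀ x ≠ 1, x.a * x.c = 0 → F x = α) (hs : ∀ x : Heisenberg K, x.a ≠ 0 → x.c ≠ 0 →
      F x = s (x.c / x.a)) :
    ∑ x, F x = F 1 + (2 * Fintype.card K + 1) * (Fintype.card K - 1) * α +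
      Fintype.card K * (Fintype.card K - 1) * ∑ t ∈ Finset.univ.erase 0, s t := by
  obtain ⟨m, hm⟩ : ∃ m, Fintype.card K = m + 1 :=
    ⟨Fintype.card K - 1, (Nat.succ_pred_eq_of_pos Fintype.card_pos).symm⟩
  have herase : (Finset.univ.erase (0 : K)).card = m := by
    rw [Finset.card_erase_of_mem (Finset.mem_univ _), Finset.card_univ, hm, Nat.add_sub_cancel]
  have hsum : ∀ g : K → ℕ, ∑ x, g x = g 0 + ∑ x ∈ Finset.univ.erase 0, g x := fun g =>
    (Finset.add_sum_erase _ g (Finset.mem_univ 0)).symm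
  rw [← Equiv.sum_comp coordinates, Fintype.sum_prod_type]
  simp_rw [Fintype.sum_prod_type]
  have h1 : ∀ a ≠ 0, ∑ b, ∑ c, F (coordinates (a, b, c)) =
      (m + 1) * (α + ∑ t ∈ Finset.univ.erase 0, s t) := by
    intro a ha
    rw [Finset.sum_const_nat (m := α + ∑ t ∈ Finset.univ.erase 0, s t), Finset.card_univ, hm]
    intro b _
    rw [hsum, hα _ (fun h => ha (congrArg Heisenberg.a h)) (mul_zero _)]
    congr 1
    refine Finset.sum_nbij' (fun c => c / a) (fun t => t * a) ?_ ?_ ?_ ?_ ?_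
    · intro c hc
      simpa [ha] using hc
    · intro c hc
      simpa [ha] using hc
    · intro c _
      exact div_mul_cancel₀ c ha
    · intro c _
      exact mul_div_cancel_right₀ c ha
    · intro c hc
      exact hs _ ha (Finset.ne_of_mem_erase hc)
  have h0 : ∑ b, ∑ c, F (coordinates (0, b, c)) = F 1 + m * α + m * (m + 1) * α := by
    have h2 : ∑ c ∈ Finset.univ.erase 0, F (coordinates (0, 0, c)) = m * α := by
      rw [Finset.sum_const_nat fun c (hc : c ∈ Finset.univ.erase 0) => hα (coordinates (0, 0, c))
        (fun h => Finset.ne_of_mem_erase hc (congrArg Heisenberg.c h)) (zero_mul _), herase]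
    have h3 : ∑ b ∈ Finset.univ.erase 0, ∑ c, F (coordinates (0, b, c)) = m * ((m + 1) * α) := by
      rw [Finset.sum_const_nat (m := (m + 1) * α), herase]
      intro b hb
      rw [Finset.sum_const_nat fun c _ => hα (coordinates (0, b, c))
        (fun h => Finset.ne_of_mem_erase hb (congrArg Heisenberg.b h)) (zero_mul _),
        Finset.card_univ, hm]
    rw [hsum, hsum, h2, h3, mul_assoc]
    rfl
  rw [hsum, h0, Finset.sum_congr rfl fun a ha => h1 a (Finset.ne_of_mem_erase ha),
    Finset.sum_const, herase, hm, Nat.add_sub_cancel, smul_eq_mul]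
  ring

end Heisenberg

theorem fixCard_le_fixCard_sq {k : ℕ} (σ : Equiv.Perm (Fin k)) :
    fixCard σ ≤ fixCard (σ * σ) := by
  refine Finset.card_le_card fun i hi => ?_
  rw [Finset.mem_filter] at hi ⊢
  exact ⟨Finset.mem_univ _, by rw [Equiv.Perm.mul_apply, hi.2, hi.2]⟩

/-- If an element `g` of order `5` normalizes a subgroup with less than five fixed points, then
it fixes all of them. -/
theorem apply_eq_of_normalizes {T V : Type*} [Group T] [Group V] {k : ℕ}
    (f : T →* Equiv.Perm (Fin k)) (φ : V →* T) {v₀ : V} (hv₀ : fixCard (f (φ v₀)) < 5) {g : T}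
    (hg : g ^ 5 = 1) (hn : ∀ v, ∃ w, φ v * g = g * φ w) {p : Fin k}
    (hp : ∀ v, f (φ v) p = p) : f g p = p := by
  classical
  have h1 : ∀ q, (∀ v, f (φ v) q = q) → ∀ v, f (φ v) (f g q) = f g q := by
    intro q hq v
    obtain ⟨w, hw⟩ := hn v
    rw [← Equiv.Perm.mul_apply, ← map_mul, hw, map_mul, Equiv.Perm.mul_apply, hq]
  have hfg : f g ^ 5 = 1 := by rw [← map_pow, hg, map_one]
  have h2 : ∀ q, (∀ v, f (φ v) (f g q) = f g q) ↔ ∀ v, f (φ v) q = q := by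
    refine fun q => ⟨fun hq => ?_, h1 q⟩
    have h3 := h1 _ (h1 _ (h1 _ (h1 _ hq)))
    have h4 : f g (f g (f g (f g (f g q)))) = q := DFunLike.congr_fun hfg q
    rwa [h4] at h3
  have h3 : (f g).subtypePerm (p := fun q => ∀ v, f (φ v) q = q) h2 = 1 := by
    refine perm_eq_one_of_pow_prime (p := 5) (by norm_num) ?_ ?_
    · refine lt_of_le_of_lt ?_ hv₀
      rw [Nat.card_eq_fintype_card, Fintype.card_subtype]
      refine Finset.card_le_card fun i hi => ?_
      rw [Finset.mem_filter] at hi ⊢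
      exact ⟨hi.1, hi.2 v₀⟩
    · rw [Equiv.Perm.subtypePerm_pow]
      ext q
      simp only [Equiv.Perm.subtypePerm_apply, hfg]
      rfl
  exact congrArg Subtype.val (DFunLike.congr_fun h3 ⟨p, hp⟩)

/-- In a field with four elements, some `ω` satisfies `ω ^ 2 + ω + 1 = 0`. -/
theorem exists_sq_add_self_add_one {K : Type*} [Field K] [Fintype K] (hK : Fintype.card K = 4) :
    (1 : K) + 1 = 0 ∧ ∃ ω : K, ω * ω + ω + 1 = 0 := by
  classical
  have hchar : ringChar K = 2 := FiniteField.even_card_iff_char_two.2 (by rw [hK])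
  have h2 : (1 : K) + 1 = 0 := by
    have := ringChar.Nat.cast_ringChar (R := K)
    rw [hchar] at this
    rw [one_add_one_eq_two]
    exact_mod_cast this
  refine ⟨h2, ?_⟩
  obtain ⟨t, -, ht⟩ := Finset.exists_mem_notMem_of_card_lt_card (s := {(0 : K), 1})
      (t := Finset.univ) (lt_of_le_of_lt Finset.card_le_two (by rw [Finset.card_univ]; omega))
  simp only [Finset.mem_insert, Finset.mem_singleton, not_or] at ht
  have h3 : t ^ 3 = 1 := by
    have := FiniteField.pow_card_sub_one_eq_one t ht.1
    rwa [hK] at this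
  refine ⟨t, (mul_eq_zero.1 (?_ : (t - 1) * _ = 0)).resolve_left (sub_ne_zero.2 ht.2)⟩
  linear_combination h3

/-- A stabilizer that contains all unitriangular matrices with `a = 0`, or all those with `c = 0`,
contains a unitriangular matrix with `a = c = 1`, provided that transvections have less than five
fixed points. -/
theorem exists_toSL_apply_eq {K : Type*} [Field K] [Fintype K] (hK : Fintype.card K = 4) {k : ℕ}
    (f : SL(3, K) →* Equiv.Perm (Fin k))
    (hf : fixCard (f (Heisenberg.toSL ⟨0, 1, 0⟩)) < 5) {p : Fin k}
    (hp : (∀ x : Heisenberg K, x.a = 0 → f (Heisenberg.toSL x) p = p) ∨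
      ∀ x : Heisenberg K, x.c = 0 → f (Heisenberg.toSL x) p = p) :
    ∃ x : Heisenberg K, x.a = 1 ∧ x.c = 1 ∧ f (Heisenberg.toSL x) p = p := by
  obtain ⟨h2, ω, hω⟩ := exists_sq_add_self_add_one hK
  rcases hp with hp | hp
  -- `g` and `h` have order `5`: they are roots of factors of the fifth cyclotomic polynomial
  · obtain ⟨g, hg⟩ : ∃ g : SL(3, K), g.1 = !![0, 1, 0; 1, ω, 0; 0, 0, 1] :=
      ⟨⟨_, by simp [Matrix.det_fin_three]; grind⟩, rfl⟩
    obtain ⟨h, hh⟩ : ∃ h : SL(3, K), h.1 = !![ω, ω + 1, 0; 1, 1, 0; 0, 0, 1] :=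
      ⟨⟨_, by simp [Matrix.det_fin_three]; grind⟩, rfl⟩
    have hgh : g * h = Heisenberg.toSL ⟨1, 0, 0⟩ := by
      refine Subtype.ext ?_
      rw [Matrix.SpecialLinearGroup.coe_mul, hg, hh, Heisenberg.coe_toSL]
      ext i j
      fin_cases i <;> fin_cases j <;> simp [Matrix.mul_apply, Fin.sum_univ_three] <;> grind
    have hg5 : g ^ 5 = 1 := by
      refine Subtype.ext ?_
      rw [Matrix.SpecialLinearGroup.coe_pow, hg, Matrix.SpecialLinearGroup.coe_one]
      ext i j
      fin_cases i <;> fin_cases j <;>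
        simp [Matrix.mul_apply, Fin.sum_univ_three, pow_succ] <;> grind
    have hh5 : h ^ 5 = 1 := by
      refine Subtype.ext ?_
      rw [Matrix.SpecialLinearGroup.coe_pow, hh, Matrix.SpecialLinearGroup.coe_one]
      ext i j
      fin_cases i <;> fin_cases j <;>
        simp [Matrix.mul_apply, Fin.sum_univ_three, pow_succ] <;> grind
    have hgp := apply_eq_of_normalizes f (Heisenberg.toSL.comp Heisenberg.columnHom)
      (v₀ := .ofAdd (1, 0)) hf hg5 (fun v => ⟨.ofAdd (ω * v.toAdd.1 + v.toAdd.2, v.toAdd.1), by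
        refine Subtype.ext ?_
        simp only [Matrix.SpecialLinearGroup.coe_mul, hg, MonoidHom.comp_apply, Heisenberg.coe_toSL]
        ext i j
        fin_cases i <;> fin_cases j <;>
          simp [Matrix.mul_apply, Fin.sum_univ_three, Heisenberg.columnHom]
        grind⟩)
      (fun v => hp _ rfl)
    have hhp := apply_eq_of_normalizes f (Heisenberg.toSL.comp Heisenberg.columnHom)
      (v₀ := .ofAdd (1, 0)) hf hh5 (fun v => ⟨.ofAdd (v.toAdd.1 + (ω + 1) * v.toAdd.2,
          v.toAdd.1 + ω * v.toAdd.2), by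
        refine Subtype.ext ?_
        simp only [Matrix.SpecialLinearGroup.coe_mul, hh, MonoidHom.comp_apply, Heisenberg.coe_toSL]
        ext i j
        fin_cases i <;> fin_cases j <;>
          simp [Matrix.mul_apply, Fin.sum_univ_three, Heisenberg.columnHom] <;> grind⟩)
      (fun v => hp _ rfl)
    refine ⟨⟨1, 0, 0⟩ * ⟨0, 0, 1⟩, by simp [Heisenberg.mul_def], by simp [Heisenberg.mul_def], ?_⟩
    rw [map_mul, map_mul, Equiv.Perm.mul_apply, hp ⟨0, 0, 1⟩ rfl, ← hgh, map_mul,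
      Equiv.Perm.mul_apply, hhp, hgp]
  · obtain ⟨g, hg⟩ : ∃ g : SL(3, K), g.1 = !![1, 0, 0; 0, 0, 1; 0, 1, ω] :=
      ⟨⟨_, by simp [Matrix.det_fin_three]; grind⟩, rfl⟩
    obtain ⟨h, hh⟩ : ∃ h : SL(3, K), h.1 = !![1, 0, 0; 0, ω, ω + 1; 0, 1, 1] :=
      ⟨⟨_, by simp [Matrix.det_fin_three]; grind⟩, rfl⟩
    have hgh : g * h = Heisenberg.toSL ⟨0, 0, 1⟩ := by
      refine Subtype.ext ?_
      rw [Matrix.SpecialLinearGroup.coe_mul, hg, hh, Heisenberg.coe_toSL]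
      ext i j
      fin_cases i <;> fin_cases j <;> simp [Matrix.mul_apply, Fin.sum_univ_three] <;> grind
    have hg5 : g ^ 5 = 1 := by
      refine Subtype.ext ?_
      rw [Matrix.SpecialLinearGroup.coe_pow, hg, Matrix.SpecialLinearGroup.coe_one]
      ext i j
      fin_cases i <;> fin_cases j <;>
        simp [Matrix.mul_apply, Fin.sum_univ_three, pow_succ] <;> grind
    have hh5 : h ^ 5 = 1 := by
      refine Subtype.ext ?_
      rw [Matrix.SpecialLinearGroup.coe_pow, hh, Matrix.SpecialLinearGroup.coe_one]
      ext i j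
      fin_cases i <;> fin_cases j <;>
        simp [Matrix.mul_apply, Fin.sum_univ_three, pow_succ] <;> grind
    have hgp := apply_eq_of_normalizes f (Heisenberg.toSL.comp Heisenberg.rowHom)
      (v₀ := .ofAdd (0, 1)) hf hg5 (fun v => ⟨.ofAdd (v.toAdd.2, v.toAdd.1 + ω * v.toAdd.2), by
        refine Subtype.ext ?_
        simp only [Matrix.SpecialLinearGroup.coe_mul, hg, MonoidHom.comp_apply, Heisenberg.coe_toSL]
        ext i j
        fin_cases i <;> fin_cases j <;>
          simp [Matrix.mul_apply, Fin.sum_univ_three, Heisenberg.rowHom]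
        grind⟩)
      (fun v => hp _ rfl)
    have hhp := apply_eq_of_normalizes f (Heisenberg.toSL.comp Heisenberg.rowHom)
      (v₀ := .ofAdd (0, 1)) hf hh5 (fun v => ⟨.ofAdd (ω * v.toAdd.1 + v.toAdd.2,
          (ω + 1) * v.toAdd.1 + v.toAdd.2), by
        refine Subtype.ext ?_
        simp only [Matrix.SpecialLinearGroup.coe_mul, hh, MonoidHom.comp_apply, Heisenberg.coe_toSL]
        ext i j
        fin_cases i <;> fin_cases j <;>
          simp [Matrix.mul_apply, Fin.sum_univ_three, Heisenberg.rowHom] <;> grind⟩)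
      (fun v => hp _ rfl)
    refine ⟨⟨1, 0, 0⟩ * ⟨0, 0, 1⟩, by simp [Heisenberg.mul_def], by simp [Heisenberg.mul_def], ?_⟩
    rw [map_mul, map_mul, Equiv.Perm.mul_apply, ← hgh, map_mul,
      Equiv.Perm.mul_apply, hhp, hgp, hp ⟨1, 0, 0⟩ rfl]

/-- The numbers of fixed points of the unitriangular matrices are `k` for the identity, a number `α`
for the transvections, and three further numbers, each at most `α`, for the matrices with
`a * c ≠ 0`, whose squares are transvections. -/
theorem specialLinearGroup_three_four_hom_eq_one {K : Type*} [Field K] (hK : Nat.card K = 4)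
    {k : ℕ} (hk : k < 21) (f : SL(3, K) →* Equiv.Perm (Fin k)) : f = 1 := by
  have : Finite K := (Nat.card_pos_iff.1 (by omega)).2
  have : Fintype K := Fintype.ofFinite K
  classical
  rw [Nat.card_eq_fintype_card] at hK
  obtain ⟨h2, -⟩ := exists_sq_add_self_add_one hK
  set α := fixCard (f (Heisenberg.toSL ⟨0, 1, 0⟩)) with hα
  have hfix : ∀ x : Heisenberg K, x ≠ 1 → x.a * x.c = 0 → fixCard (f (Heisenberg.toSL x)) = α := by
    intro x hx hx'
    obtain ⟨g, hg⟩ := x.exists_toSL_mul_eq_of_mul_eq_zero hx hx'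
    exact (fixCard_map_eq_of_mul_eq f hg).symm
  have hαk : α ≤ k := fixCard_le _
  have h16 := card_dvd_sub_fixCard ((f.comp Heisenberg.toSL).comp Heisenberg.columnHom)
    (a := α) (fun v hv => hfix _ (fun h => hv ?_) (zero_mul _)) hαk
  swap
  · exact Prod.ext (congrArg Heisenberg.b h) (congrArg Heisenberg.c h)
  rw [Fintype.card_multiplicative, Fintype.card_prod, hK] at h16
  by_cases heq : α = k
  · refine specialLinearGroup_hom_eq_one (by simp) f (show (0 : Fin 3) ≠ 2 by decide)
      (one_ne_zero (α := K)) ?_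
    rw [hα, fixCard_eq_iff] at heq
    rw [← heq]
    refine congrArg f (Subtype.ext ?_)
    rw [Matrix.SpecialLinearGroup.transvection_coe, Heisenberg.coe_toSL]
    ext i j
    fin_cases i <;> fin_cases j <;> simp
  exfalso
  -- the remaining case is `k = α + 16` with `α ≤ 4`
  let s : K → ℕ := fun t => fixCard (f (Heisenberg.toSL ⟨1, 0, t⟩))
  have hs : ∀ x : Heisenberg K, x.a ≠ 0 → x.c ≠ 0 →
      fixCard (f (Heisenberg.toSL x)) = s (x.c / x.a) := by
    intro x hx _
    obtain ⟨g, hg⟩ := x.exists_toSL_mul_eq_of_ne_zero hx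
    exact (fixCard_map_eq_of_mul_eq f hg).symm
  have hsα : ∀ t ∈ Finset.univ.erase 0, s t ≤ α := by
    intro t ht
    refine (fixCard_le_fixCard_sq _).trans_eq ?_
    rw [← map_mul, ← map_mul]
    refine hfix _ (fun h => Finset.ne_of_mem_erase ht ?_) ?_
    · simpa [Heisenberg.mul_def, Heisenberg.one_def] using congrArg Heisenberg.b h
    · simp [Heisenberg.mul_def, h2]
  have hS : ∑ t ∈ Finset.univ.erase 0, s t ≤ 3 * α := by
    refine (Finset.sum_le_card_nsmul _ _ _ hsα).trans_eq ?_
    rw [Finset.card_erase_of_mem (Finset.mem_univ _), Finset.card_univ, hK, smul_eq_mul]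
  have h64 := card_dvd_sum_fixCard (f.comp Heisenberg.toSL)
  simp only [MonoidHom.comp_apply] at h64
  rw [Heisenberg.sum_eq _ α s hfix hs, Heisenberg.card_eq, hK, map_one, map_one, fixCard_one] at h64
  -- with `S` for the sum, `16 + 28 * α + 12 * S` is divisible by `64`, and `S ≤ 3 * α`
  obtain ⟨hα4, hS0⟩ : α = 4 ∧ ∑ t ∈ Finset.univ.erase 0, s t = 0 := by
    rcases (by omega : α = 0 ∨ α = 1 ∨ α = 2 ∨ α = 3 ∨ α = 4) with h | h | h | h | h <;> omega
  rw [Finset.sum_eq_zero_iff] at hS0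
  have hno : ∀ (x : Heisenberg K) (p : Fin k), f (Heisenberg.toSL x) p = p → x.a * x.c = 0 := by
    intro x p hxp
    by_contra h
    obtain ⟨ha, hc⟩ := mul_ne_zero_iff.1 h
    have h1 := hs x ha hc
    rw [hS0 _ (Finset.mem_erase.2 ⟨div_ne_zero hc ha, Finset.mem_univ _⟩), fixCard,
      Finset.card_eq_zero] at h1
    exact Finset.notMem_empty p (h1 ▸ Finset.mem_filter.2 ⟨Finset.mem_univ _, hxp⟩)
  -- the stabilizer of a fixed point of the center has order at least `16`
  obtain ⟨p, hp⟩ : ∃ p, f (Heisenberg.toSL ⟨0, 1, 0⟩) p = p := by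
    have h1 : 0 < fixCard (f (Heisenberg.toSL (⟨0, 1, 0⟩ : Heisenberg K))) := by omega
    obtain ⟨p, hp⟩ := Finset.card_pos.1 h1
    exact ⟨p, (Finset.mem_filter.1 hp).2⟩
  let _ := MulAction.compHom (Fin k) (f.comp Heisenberg.toSL)
  have hsmul : ∀ (x : Heisenberg K) (q : Fin k), x • q = f (Heisenberg.toSL x) q := fun _ _ => rfl
  have horb : Fintype.card (MulAction.orbit (Heisenberg K) p) ≤ 4 := by
    rw [← hα4, hα, fixCard, ← Set.toFinset_card]
    refine Finset.card_le_card fun q hq => Finset.mem_filter.2 ⟨Finset.mem_univ _, ?_⟩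
    obtain ⟨x, rfl⟩ := Set.mem_toFinset.1 hq
    change f (Heisenberg.toSL ⟨0, 1, 0⟩) (x • p) = x • p
    have hcomm : (⟨0, 1, 0⟩ : Heisenberg K) * x = x * ⟨0, 1, 0⟩ := by
      ext <;> simp [Heisenberg.mul_def, add_comm]
    rw [← hsmul, ← mul_smul, hcomm, mul_smul, hsmul ⟨0, 1, 0⟩, hp]
  have hstab := MulAction.card_orbit_mul_card_stabilizer_eq_card_group (Heisenberg K) p
  rw [Heisenberg.card_eq, hK] at hstab
  have h16' : 16 ≤ Fintype.card (MulAction.stabilizer (Heisenberg K) p) := by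
    by_contra! hlt
    have := Nat.mul_le_mul horb (Nat.le_of_lt_succ hlt)
    omega
  have hmem : ∀ (φ : Multiplicative (K × K) →* Heisenberg K) (C : Heisenberg K → Prop),
      (∀ x, C x → x ∈ φ.range) → (∀ x ∈ MulAction.stabilizer (Heisenberg K) p, C x) →
      ∀ x, C x → f (Heisenberg.toSL x) p = p := by
    intro φ C hC hC' x hx
    have h1 : MulAction.stabilizer (Heisenberg K) p = φ.range := by
      refine Subgroup.eq_of_le_of_card_ge (fun y hy => hC y (hC' y hy)) ?_
      rw [Nat.card_eq_fintype_card (α := MulAction.stabilizer (Heisenberg K) p)]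
      refine le_trans ?_ h16'
      refine (Nat.card_le_card_of_surjective _ φ.rangeRestrict_surjective).trans_eq ?_
      rw [Nat.card_eq_fintype_card, Fintype.card_multiplicative, Fintype.card_prod, hK]
    exact MulAction.mem_stabilizer_iff.1 (h1 ▸ hC x hx)
  have key : (∀ x : Heisenberg K, x.a = 0 → f (Heisenberg.toSL x) p = p) ∨
      ∀ x : Heisenberg K, x.c = 0 → f (Heisenberg.toSL x) p = p := by
    refine (Heisenberg.forall_eq_zero_or_forall_eq_zero _
      (fun x hx => hno x p (MulAction.mem_stabilizer_iff.1 hx))).imp ?_ ?_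
    · exact hmem Heisenberg.columnHom (fun x => x.a = 0)
        fun x hx => ⟨.ofAdd (x.b, x.c), Heisenberg.ext hx.symm rfl rfl⟩
    · exact hmem Heisenberg.rowHom (fun x => x.c = 0)
        fun x hx => ⟨.ofAdd (x.a, x.b), Heisenberg.ext rfl rfl hx.symm⟩
  obtain ⟨x, hxa, hxc, hx⟩ := exists_toSL_apply_eq hK f (by omega) key
  have := hno x p hx
  rw [hxa, hxc, mul_one] at this
  exact one_ne_zero this

end PGammaLThreeFour

/-! ### Actions of low degree of special linear groups -/

section LowDegree

open Matrix.SpecialLinearGroup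

/-- A group that acts on `α` and permutes a family of finite subsets of `α` acts on the set of
indices of the family. -/
theorem exists_permHom_of_finsets {T α ι : Type*} [Group T] [DecidableEq α]
    (ρ : T → α → α) (hρ : ρ 1 = id)
    (hρ' : ∀ t u, ρ (t * u) = ρ t ∘ ρ u) (B : ι → Finset α) (hB : Function.Injective B)
    (h : ∀ t i, ∃ j, (B i).image (ρ t) = B j) :
    ∃ ψ : T →* Equiv.Perm ι, ∀ t i, B (ψ t i) = (B i).image (ρ t) := by
  choose s hs using h
  have hmul : ∀ t u i, s t (s u i) = s (t * u) i := by
    intro t u i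
    refine hB ?_
    rw [← hs, ← hs, ← hs, Finset.image_image, hρ']
  have hone : ∀ i, s 1 i = i := by
    intro i
    refine hB ?_
    rw [← hs, hρ, Finset.image_id]
  exact ⟨{ toFun := fun t => ⟨s t, s t⁻¹, fun i => by rw [hmul, inv_mul_cancel, hone],
              fun i => by rw [hmul, mul_inv_cancel, hone]⟩
           map_one' := Equiv.ext hone
           map_mul' := fun t u => Equiv.ext fun i => (hmul t u i).symm }, fun t i => (hs t i).symm⟩

/-- The action of `SL_n(K)` on matrices by `S ↦ g * S * σ(g)ᵀ`, for an endomorphism `σ` of `K`: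
the action on bilinear forms for the identity `σ`, on sesquilinear forms in general. -/
def formAction {n K : Type*} [Fintype n] [DecidableEq n] [Field K] (σ : K →+* K)
    (g : Matrix.SpecialLinearGroup n K) (S : Matrix n n K) : Matrix n n K :=
  g.1 * S * (g.1.map σ).transpose

section FormAction

variable {n K : Type*} [Fintype n] [DecidableEq n] [Field K] (σ : K →+* K)

theorem formAction_one : formAction σ (1 : Matrix.SpecialLinearGroup n K) = id := by
  funext S
  simp [formAction]

theorem formAction_mul (g h : Matrix.SpecialLinearGroup n K) :
    formAction σ (g * h) = formAction σ g ∘ formAction σ h := by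
  funext S
  simp [formAction, Matrix.map_mul, Matrix.transpose_mul, mul_assoc]

theorem formAction_inv_comp (g : Matrix.SpecialLinearGroup n K) :
    formAction σ g⁻¹ ∘ formAction σ g = id := by
  rw [← formAction_mul, inv_mul_cancel, formAction_one]

theorem formAction_injective (g : Matrix.SpecialLinearGroup n K) :
    Function.Injective (formAction σ g) :=
  Function.LeftInverse.injective (congrFun (formAction_inv_comp σ g))

end FormAction

/-- If the transvections whose entry lies in a generating set permute a finite family of finite sets
of forms, all of the same size, then so does `SL_d(K)`. The center acts trivially if its elements `c` satisfy `c * σ(c) = 1`. -/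
theorem exists_permHom_of_transvections {d m r : ℕ} [Nontrivial (Fin d)] {K : Type*} [Field K]
    [DecidableEq K] (σ : K →+* K) (hσ : ∀ c, c ^ d = 1 → c * σ c = 1)
    (B : Fin m → Fin r → Matrix (Fin d) (Fin d) K) (hB : ∀ i j, (∀ u, ∃ v, B i u = B j v) → i = j)
    (hBi : ∀ i, Function.Injective (B i)) {A : Set K} (hA : AddSubgroup.closure A = ⊤)
    (h : ∀ p q : Fin d, p ≠ q → ∀ a ∈ A, ∀ i, ∃ j, ∀ u, ∃ v,
      Matrix.transvection p q a * B i u * ((Matrix.transvection p q a).map σ).transpose = B j v) :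
    ∃ ψ : SL(d, K) →* Equiv.Perm (Fin m), Subgroup.center SL(d, K) ≤ ψ.ker ∧
      ∀ t i u, ∃ v, formAction σ t (B i u) = B (ψ t i) v := by
  let C : Fin m → Finset (Matrix (Fin d) (Fin d) K) := fun i => Finset.univ.image (B i)
  have hC : Function.Injective C := by
    intro i j hij
    refine hB i j fun u => ?_
    have h1 : B i u ∈ C j := hij ▸ Finset.mem_image_of_mem _ (Finset.mem_univ u)
    obtain ⟨v, -, hv⟩ := Finset.mem_image.1 h1
    exact ⟨v, hv.symm⟩
  have hr : ∀ i, (C i).card = r := fun i => by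
    rw [Finset.card_image_of_injective _ (hBi i), Finset.card_univ, Fintype.card_fin]
  let N : Subgroup SL(d, K) :=
    { carrier := {t | ∀ i, ∃ j, (C i).image (formAction σ t) = C j}
      one_mem' := fun i => ⟨i, by rw [formAction_one, Finset.image_id]⟩
      mul_mem' := by
        intro t u ht hu i
        obtain ⟨j, hj⟩ := hu i
        obtain ⟨l, hl⟩ := ht j
        refine ⟨l, ?_⟩
        rw [← hl, ← hj, formAction_mul, ← Finset.image_image]
      inv_mem' := by
        intro t ht
        choose s hs using ht
        have hinj : Function.Injective s := by
          intro i j hij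
          refine hC (Finset.image_injective (formAction_injective σ t) ?_)
          rw [hs, hs, hij]
        intro i
        obtain ⟨j, rfl⟩ := Finite.surjective_of_injective hinj i
        refine ⟨j, ?_⟩
        rw [← hs, Finset.image_image, formAction_inv_comp, Finset.image_id] }
  have hN : N = ⊤ := by
    refine specialLinearGroup_eq_top_of_transvection_mem fun p q hpq a => ?_
    have ha : a ∈ AddSubgroup.closure A := hA ▸ AddSubgroup.mem_top a
    induction ha using AddSubgroup.closure_induction with
    | zero => rw [transvection_coeff_zero]; exact one_mem N
    | add a b _ _ ha hb => rw [transvection_add]; exact mul_mem ha hb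
    | neg a _ ha => rw [← transvection_inv]; exact inv_mem ha
    | mem a ha =>
    intro i
    obtain ⟨j, hj⟩ := h p q hpq a ha i
    refine ⟨j, Finset.eq_of_subset_of_card_le (Finset.image_subset_iff.2 fun S hS => ?_) ?_⟩
    · obtain ⟨u, -, rfl⟩ := Finset.mem_image.1 hS
      obtain ⟨v, hv⟩ := hj u
      exact Finset.mem_image.2 ⟨v, Finset.mem_univ v, hv.symm⟩
    rw [Finset.card_image_of_injective _ (formAction_injective σ _), hr, hr]
  obtain ⟨ψ, hψ⟩ := exists_permHom_of_finsets (formAction σ) (formAction_one σ)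
    (formAction_mul σ) C hC
    (fun t => (hN ▸ Subgroup.mem_top t : t ∈ N))
  refine ⟨ψ, fun t ht => ?_, fun t i u => ?_⟩
  · obtain ⟨c, hc, hct⟩ := mem_center_iff.1 ht
    have hid : formAction σ t = id := by
      funext S
      rw [Fintype.card_fin] at hc
      rw [formAction, ← hct]
      ext p q
      simp only [Matrix.scalar_apply, Matrix.diagonal_map (map_zero σ), Matrix.diagonal_transpose,
        Matrix.mul_diagonal, Matrix.diagonal_mul, id_eq]
      rw [mul_right_comm, hσ c hc, one_mul]
    refine MonoidHom.mem_ker.2 (Equiv.ext fun i => hC ?_)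
    rw [hψ, hid, Finset.image_id]
    rfl
  · have h1 : formAction σ t (B i u) ∈ C (ψ t i) := by
      rw [hψ]
      exact Finset.mem_image_of_mem _ (Finset.mem_image_of_mem _ (Finset.mem_univ u))
    obtain ⟨v, -, hv⟩ := Finset.mem_image.1 h1
    exact ⟨v, hv.symm⟩

theorem IsExtensionOfPSL.isKSolvable {d m k : ℕ} {K : Type*} [Field K] {G : Type*} [Group G]
    (hG : IsExtensionOfPSL d K G) (ψ : SL(d, K) →* Equiv.Perm (Fin m))
    (hψ : ψ.ker = Subgroup.center SL(d, K)) (hm : m ≤ k) : IsKSolvable k G := by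
  obtain ⟨φ, P, hφ, hP, hP', hG⟩ := hG
  exact isKSolvable_of_ker_eq (by rwa [Fintype.card_fin]) φ ψ (hφ.trans hψ.symm) hP hP' hG

/-- For `SL_2(K)` the kernel is the center as soon as one of the sets is moved. -/
theorem exists_permHom_of_transvections_two {m r : ℕ} {K : Type*} [Field K] [DecidableEq K]
    (hK : 4 ≤ Nat.card K) (σ : K →+* K) (hσ : ∀ c, c ^ 2 = 1 → c * σ c = 1)
    (B : Fin m → Fin r → Matrix (Fin 2) (Fin 2) K) (hB : ∀ i j, (∀ u, ∃ v, B i u = B j v) → i = j)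
    (hBi : ∀ i, Function.Injective (B i)) {A : Set K} (hA : AddSubgroup.closure A = ⊤)
    (h : ∀ p q : Fin 2, p ≠ q → ∀ a ∈ A, ∀ i, ∃ j, ∀ u, ∃ v,
      Matrix.transvection p q a * B i u * ((Matrix.transvection p q a).map σ).transpose = B j v)
    (hne : ∃ i u, ∀ v,
      Matrix.transvection 0 1 1 * B i u * ((Matrix.transvection 0 1 1).map σ).transpose ≠ B i v) :
    ∃ ψ : SL(2, K) →* Equiv.Perm (Fin m), ψ.ker = Subgroup.center SL(2, K) := by
  obtain ⟨ψ, hψ, hψ'⟩ := exists_permHom_of_transvections σ hσ B hB hBi hA h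
  refine ⟨ψ, le_antisymm (fun x hx => ?_) hψ⟩
  by_contra hxc
  obtain ⟨i, u, hu⟩ := hne
  obtain ⟨v, hv⟩ := hψ' (transvection (zero_ne_one : (0 : Fin 2) ≠ 1) 1) i u
  rw [specialLinearGroup_two_eq_one hK ψ hxc hx] at hv
  exact hu v hv

theorem zmod_closure_one (n : ℕ) : AddSubgroup.closure ({1} : Set (ZMod n)) = ⊤ := by
  rw [eq_top_iff]
  intro a _
  obtain ⟨z, rfl⟩ := ZMod.intCast_surjective a
  rw [← zsmul_one]
  exact zsmul_mem (AddSubgroup.subset_closure (Set.mem_singleton (1 : ZMod n))) z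

/-- Five sets of quadratic forms over `F_5` that correspond to the quaternion subgroups of
`SL_2(5)`. -/
def quaternionFormsFive : Fin 5 → Fin 6 → Matrix (Fin 2) (Fin 2) (ZMod 5) :=
  let s (x y z : Matrix (Fin 2) (Fin 2) (ZMod 5)) := ![x, y, z, -x, -y, -z]
  ![s !![0, 2; 2, 0] !![1, 0; 0, 1] !![2, 0; 0, 3], s !![0, 2; 2, 2] !![1, 3; 3, 0] !![2, 1; 1, 1],
    s !![0, 2; 2, 1] !![1, 4; 4, 2] !![2, 3; 3, 0], s !![0, 2; 2, 4] !![1, 1; 1, 2] !![2, 2; 2, 0],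
    s !![0, 2; 2, 3] !![1, 2; 2, 0] !![2, 4; 4, 1]]

theorem IsPGL.isKSolvable_two_five {X : Type*} {G : Subgroup (Equiv.Perm X)}
    (hG : IsPGL 2 (ZMod 5) G) {k : ℕ} (hk : 5 ≤ k) : IsKSolvable k G := by
  obtain ⟨ψ, hψ⟩ := exists_permHom_of_transvections_two (by rw [Nat.card_zmod]; norm_num)
    (RingHom.id (ZMod 5)) (by decide +kernel) quaternionFormsFive (by decide +kernel)
    (by decide +kernel) (zmod_closure_one 5)
    (by simp only [Set.mem_singleton_iff, forall_eq]; decide +kernel) (by decide +kernel)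
  exact hG.isExtensionOfPSL.isKSolvable ψ hψ hk

/-- Seven sets of quadratic forms over `F_7` that correspond to one of the two classes of
quaternion subgroups of `SL_2(7)`. -/
def quaternionFormsSeven : Fin 7 → Fin 6 → Matrix (Fin 2) (Fin 2) (ZMod 7) :=
  let s (x y z : Matrix (Fin 2) (Fin 2) (ZMod 7)) := ![x, y, z, -x, -y, -z]
  ![s !![1, 0; 0, 1] !![2, 3; 3, 5] !![3, 5; 5, 4], s !![1, 6; 6, 2] !![2, 1; 1, 1] !![3, 2; 2, 4],
    s !![1, 1; 1, 2] !![2, 5; 5, 6] !![3, 1; 1, 3], s !![1, 4; 4, 3] !![2, 4; 4, 5] !![3, 3; 3, 1],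
    s !![1, 2; 2, 5] !![2, 0; 0, 4] !![3, 4; 4, 1], s !![1, 3; 3, 3] !![2, 2; 2, 6] !![3, 0; 0, 5],
    s !![1, 5; 5, 5] !![2, 6; 6, 1] !![3, 6; 6, 3]]

theorem IsPGL.isKSolvable_two_seven {X : Type*} {G : Subgroup (Equiv.Perm X)}
    (hG : IsPGL 2 (ZMod 7) G) {k : ℕ} (hk : 7 ≤ k) : IsKSolvable k G := by
  obtain ⟨ψ, hψ⟩ := exists_permHom_of_transvections_two (by rw [Nat.card_zmod]; norm_num)
    (RingHom.id (ZMod 7)) (by decide +kernel) quaternionFormsSeven (by decide +kernel)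
    (by decide +kernel) (zmod_closure_one 7)
    (by simp only [Set.mem_singleton_iff, forall_eq]; decide +kernel) (by decide +kernel)
  exact hG.isExtensionOfPSL.isKSolvable ψ hψ hk

end LowDegree

/-! ### `PΓL_2(9)` and `PGL_4(2)` as groups of degree six and eight -/

section SixAndEight

open Matrix.SpecialLinearGroup

/-- The field with nine elements as `F_3(i)` with `i ^ 2 = -1`. -/
abbrev NineField : Type := QuadraticAlgebra (ZMod 3) (-1) 0

instance factNineField : Fact (∀ r : ZMod 3, r ^ 2 ≠ -1 + 0 * r) := ⟨by decide⟩

instance : Fintype NineField := Fintype.ofEquiv _ (QuadraticAlgebra.equivProd (-1) 0).symm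

theorem card_nineField : Fintype.card NineField = 9 := rfl

theorem nineField_closure : AddSubgroup.closure ({1, ⟨0, 1⟩} : Set NineField) = ⊤ := by
  rw [eq_top_iff]
  intro a _
  have h : ∀ a : NineField, ∃ m n : Fin 3, a = m.1 • (1 : NineField) + n.1 • ⟨0, 1⟩ := by
    decide +kernel
  obtain ⟨m, n, rfl⟩ := h a
  exact add_mem (nsmul_mem (AddSubgroup.subset_closure (by simp)) _)
    (nsmul_mem (AddSubgroup.subset_closure (by simp)) _)

/-- Six Hermitian forms over `F_9`. The group `SL_2(9)` permutes the six sets that consist of the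
differences of one of these forms with the others. -/
def hermitianForms : Fin 6 → Matrix (Fin 2) (Fin 2) NineField :=
  ![0, !![0, ⟨0, 1⟩; ⟨0, 2⟩, 0], !![0, ⟨0, 2⟩; ⟨0, 1⟩, 1], !![1, ⟨0, 2⟩; ⟨0, 1⟩, 0],
    !![1, ⟨1, 2⟩; ⟨1, 1⟩, 1], !![1, ⟨2, 2⟩; ⟨2, 1⟩, 1]]

theorem exists_permHom_nineField :
    ∃ ψ : SL(2, NineField) →* Equiv.Perm (Fin 6), ψ.ker = Subgroup.center SL(2, NineField) := by
  refine exists_permHom_of_transvections_two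
    (by rw [Nat.card_eq_fintype_card, card_nineField]; norm_num)
    (starRingEnd NineField) (by decide +kernel)
    (fun i (u : Fin 5) => hermitianForms i - hermitianForms (i.succAbove u)) (by decide +kernel)
    (by decide +kernel) nineField_closure ?_ (by decide +kernel)
  simp only [Set.mem_insert_iff, Set.mem_singleton_iff, forall_eq_or_imp, forall_eq]
  decide +kernel

theorem center_eq_comap_map {n : Type*} [Fintype n] [DecidableEq n] {R S : Type*} [CommRing R]
    [CommRing S] (e : R ≃+* S) :
    (Subgroup.center (Matrix.SpecialLinearGroup n S)).comap
      (Matrix.SpecialLinearGroup.map (e : R →+* S)) =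
      Subgroup.center (Matrix.SpecialLinearGroup n R) := by
  have hinj : Function.Injective
      (Matrix.SpecialLinearGroup.map (n := n) (e : R →+* S)) := by
    intro g h hgh
    refine Subtype.ext (Matrix.map_injective e.injective (congrArg Subtype.val hgh))
  have hsurj : Function.Surjective
      (Matrix.SpecialLinearGroup.map (n := n) (e : R →+* S)) := by
    intro g
    refine ⟨Matrix.SpecialLinearGroup.map (e.symm : S →+* R) g, Subtype.ext ?_⟩
    ext i j
    exact e.apply_symm_apply _
  ext g
  rw [Subgroup.mem_comap, Subgroup.mem_center_iff, Subgroup.mem_center_iff, hsurj.forall]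
  exact forall_congr' fun h => by rw [← map_mul, ← map_mul, hinj.eq_iff]

theorem IsPGammaL.isKSolvable_two_nine {X : Type*} {G : Subgroup (Equiv.Perm X)}
    (hG : IsPGammaL 2 (GaloisField 3 2) G) {k : ℕ} (hk : 6 ≤ k) : IsKSolvable k G := by
  have : Fintype (GaloisField 3 2) := Fintype.ofFinite _
  let e : GaloisField 3 2 ≃+* NineField := FiniteField.ringEquivOfCardEq (by
    rw [card_nineField, ← Nat.card_eq_fintype_card, GaloisField.card 3 2 (by norm_num)]; norm_num)
  obtain ⟨ψ, hψ⟩ := exists_permHom_nineField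
  refine hG.isExtensionOfPSL.isKSolvable
    (ψ.comp (Matrix.SpecialLinearGroup.map (e : GaloisField 3 2 →+* NineField))) ?_ hk
  rw [← MonoidHom.comap_ker, hψ, center_eq_comap_map]

/-- Eight alternating forms over `F_2`. The group `SL_4(2)` permutes the eight sets that consist of
the differences of one of these forms with the others; all these differences are nondegenerate. -/
def alternatingForms : Fin 8 → Matrix (Fin 4) (Fin 4) (ZMod 2) :=
  let s (a b c d e f : ZMod 2) : Matrix (Fin 4) (Fin 4) (ZMod 2) :=
    !![0, a, b, c; a, 0, d, e; b, d, 0, f; c, e, f, 0]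
  ![0, s 0 0 1 1 0 0, s 0 1 0 1 1 0, s 0 1 1 0 1 1, s 1 0 0 1 1 1, s 1 0 1 0 0 1, s 1 1 0 1 0 1,
    s 1 1 1 0 1 0]

/-- The set of differences of one form with the others has exactly one element in common with any
other set of this kind. -/
theorem alternatingForms_sub_eq : ∀ i j, i ≠ j → ∀ u v : Fin 7,
    alternatingForms i - alternatingForms (i.succAbove u) =
      alternatingForms j - alternatingForms (j.succAbove v) →
    alternatingForms i - alternatingForms (i.succAbove u) =
      alternatingForms i - alternatingForms j := by
  decide +kernel

theorem alternatingForms_sub_comm : ∀ i j, alternatingForms i - alternatingForms j =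
    alternatingForms j - alternatingForms i := by
  decide +kernel

theorem alternatingForms_span : ∀ a b : Fin 4, a ≠ b → ∃ i j k,
    Matrix.single a b 1 + Matrix.single b a 1 =
      alternatingForms i + alternatingForms j + alternatingForms k := by
  decide +kernel

/-- As the eight forms span the space of alternating forms, only the identity fixes all of them. -/
theorem eq_one_of_formAction_alternatingForms {g : SL(4, ZMod 2)}
    (hfix : ∀ i, formAction (RingHom.id _) g (alternatingForms i) = alternatingForms i) :
    g = 1 := by
  have hoff : ∀ p a, p ≠ a → g.1 p a = 0 := by
    intro p a hpa
    obtain ⟨b, hba, hbp⟩ : ∃ b, b ≠ a ∧ b ≠ p := by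
      revert p a
      decide
    obtain ⟨i, j, k, hijk⟩ := alternatingForms_span a b hba.symm
    have h1 : g.1 * (Matrix.single a b 1 + Matrix.single b a 1) * g.1.transpose =
        Matrix.single a b 1 + Matrix.single b a 1 := by
      have e1 := hfix i
      have e2 := hfix j
      have e3 := hfix k
      simp only [formAction, RingHom.coe_id, Matrix.map_id] at e1 e2 e3
      rw [hijk, mul_add, mul_add, add_mul, add_mul, e1, e2, e3]
    have h2 : g.1.transpose * (g⁻¹).1.transpose = 1 := by
      rw [← Matrix.transpose_mul, ← Matrix.SpecialLinearGroup.coe_mul, inv_mul_cancel,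
        Matrix.SpecialLinearGroup.coe_one, Matrix.transpose_one]
    have h3 := congrArg (· * (g⁻¹).1.transpose) h1
    simp only [mul_assoc, h2, mul_one] at h3
    have h4 := congrFun (congrFun h3 p) b
    simpa [Matrix.mul_add, Matrix.add_mul, Matrix.add_apply, hpa, hbp, hbp.symm, hpa.symm, hba,
      hba.symm] using h4
  have hdiag : g.1 = Matrix.diagonal fun i => g.1 i i := by
    ext p a
    by_cases hpa : p = a
    · subst hpa
      simp
    · rw [hoff p a hpa, Matrix.diagonal_apply_ne _ hpa]
  have hdet := g.2
  rw [hdiag, Matrix.det_diagonal] at hdet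
  have h2 : ∀ x : ZMod 2, x ≠ 0 → x = 1 := by decide
  refine Subtype.ext ?_
  rw [hdiag, Matrix.SpecialLinearGroup.coe_one, ← Matrix.diagonal_one]
  congr 1
  funext i
  refine h2 _ fun h0 => ?_
  exact zero_ne_one ((Finset.prod_eq_zero (f := fun i => g.1 i i) (Finset.mem_univ i) h0).symm.trans
    hdet)

theorem exists_permHom_alternatingForms :
    ∃ ψ : SL(4, ZMod 2) →* Equiv.Perm (Fin 8), Subgroup.center SL(4, ZMod 2) ≤ ψ.ker ∧
      ∀ t i u, ∃ v, formAction (RingHom.id _) t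
        (alternatingForms i - alternatingForms (i.succAbove u)) =
          alternatingForms (ψ t i) - alternatingForms ((ψ t i).succAbove v) :=
  exists_permHom_of_transvections (RingHom.id (ZMod 2))
    (by decide +kernel) (fun i (u : Fin 7) => alternatingForms i - alternatingForms (i.succAbove u))
    (by decide +kernel) (by decide +kernel) (zmod_closure_one 2)
    (by simp only [Set.mem_singleton_iff, forall_eq]; decide +kernel)

theorem exists_permHom_four_two :
    ∃ ψ : SL(4, ZMod 2) →* Equiv.Perm (Fin 8), ψ.ker = Subgroup.center SL(4, ZMod 2) := by
  obtain ⟨ψ, hψ, hψ'⟩ := exists_permHom_alternatingForms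
  refine ⟨ψ, le_antisymm (fun g hg => ?_) hψ⟩
  have hfix : ∀ i j, formAction (RingHom.id _) g (alternatingForms i - alternatingForms j) =
      alternatingForms i - alternatingForms j := by
    intro i j
    by_cases hij : i = j
    · rw [hij, sub_self]
      simp [formAction]
    obtain ⟨u, hu⟩ := Fin.exists_succAbove_eq (Ne.symm hij)
    obtain ⟨v, hv⟩ := Fin.exists_succAbove_eq hij
    obtain ⟨u', hu'⟩ := hψ' g i u
    obtain ⟨v', hv'⟩ := hψ' g j v
    rw [MonoidHom.mem_ker.1 hg, Equiv.Perm.one_apply] at hu' hv'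
    rw [hu] at hu'
    rw [hv, ← alternatingForms_sub_comm i j, hu'] at hv'
    rw [hu']
    exact alternatingForms_sub_eq i j hij u' v' hv'
  have h1 : g = 1 := eq_one_of_formAction_alternatingForms fun i => by
    have h := hfix i 0
    rwa [show alternatingForms 0 = 0 from rfl, sub_zero] at h
  rw [h1]
  exact one_mem _

theorem IsPGL.isKSolvable_four_two {X : Type*} {G : Subgroup (Equiv.Perm X)}
    (hG : IsPGL 4 (ZMod 2) G) {k : ℕ} (hk : 8 ≤ k) : IsKSolvable k G := by
  obtain ⟨ψ, hψ⟩ := exists_permHom_four_two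
  exact hG.isExtensionOfPSL.isKSolvable ψ hψ hk

end SixAndEight

/-! ### The classification -/

theorem IsPGammaL.nine_le_of_isKSolvable {X : Type*} {G : Subgroup (Equiv.Perm X)}
    (hG : IsPGammaL 2 (GaloisField 2 3) G) {k : ℕ} (h : IsKSolvable k G) : 9 ≤ k := by
  have hK : Nat.card (GaloisField 2 3) = 8 := by
    rw [GaloisField.card 2 3 (by norm_num)]; norm_num
  by_contra! hk
  exact hG.isExtensionOfPSL.not_isKSolvable le_rfl (specialLinearGroup_two_perfect (by omega))
    (specialLinearGroup_two_eight_hom_eq_one hK hk) h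

theorem IsPGammaL.six_le_of_isKSolvable {X : Type*} {G : Subgroup (Equiv.Perm X)}
    (hG : IsPGammaL 2 (GaloisField 3 2) G) {k : ℕ} (h : IsKSolvable k G) : 6 ≤ k := by
  have hK : Nat.card (GaloisField 3 2) = 9 := by
    rw [GaloisField.card 3 2 (by norm_num)]; norm_num
  by_contra! hk
  exact hG.isExtensionOfPSL.not_isKSolvable le_rfl (specialLinearGroup_two_perfect (by omega))
    (specialLinearGroup_two_nine_hom_eq_one hK hk) h

theorem IsPGammaL.twentyOne_le_of_isKSolvable {X : Type*} {G : Subgroup (Equiv.Perm X)}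
    (hG : IsPGammaL 3 (GaloisField 2 2) G) {k : ℕ} (h : IsKSolvable k G) : 21 ≤ k := by
  have hK : Nat.card (GaloisField 2 2) = 4 := by
    rw [GaloisField.card 2 2 (by norm_num)]; norm_num
  by_contra! hk
  exact hG.isExtensionOfPSL.not_isKSolvable (by norm_num)
    (commutator_specialLinearGroup_eq_top (by simp))
    (specialLinearGroup_three_four_hom_eq_one hK hk) h

theorem IsPGL.eight_le_of_isKSolvable {X : Type*} {G : Subgroup (Equiv.Perm X)}
    (hG : IsPGL 4 (ZMod 2) G) {k : ℕ} (h : IsKSolvable k G) : 8 ≤ k := by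
  by_contra! hk
  exact hG.isExtensionOfPSL.not_isKSolvable (by norm_num)
    (commutator_specialLinearGroup_eq_top (by simp))
    (specialLinearGroup_four_two_hom_eq_one hk) h

theorem mainTheorem3 {X : Type*} [Fintype X] [DecidableEq X] (n : ℕ) (hn : Fintype.card X = n)
    (G : Subgroup (Equiv.Perm X)) (hG : IsOnMullerList G) (k : ℕ) :
    IsKSolvable k G ↔
      ((G = ⊤ ∧ n ≤ 4) ∨ (n.Prime ∧ IsBetweenCyclicAndDihedral n G)) ∨
      (n ≤ k ∧
        (G = ⊤ ∨
          (Odd n ∧ 5 ≤ n ∧ G = alternatingGroup X) ∨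
          (n = 11 ∧ (IsPSLTwoEleven G ∨ PermIso G mathieuEleven)) ∨
          (n = 23 ∧ PermIso G mathieuTwentyThree) ∨
          (n = 7 ∧ IsPGL 3 (ZMod 2) G) ∨
          (n = 13 ∧ IsPGL 3 (ZMod 3) G) ∨
          (n = 31 ∧ IsPGL 5 (ZMod 2) G) ∨
          (n = 21 ∧ IsPGammaL 3 (GaloisField 2 2) G) ∨
          (n = 9 ∧ IsPGammaL 2 (GaloisField 2 3) G))) ∨
      (IsPGL 2 (ZMod 5) G ∧ 5 ≤ k) ∨
      (IsPGammaL 2 (GaloisField 3 2) G ∧ 6 ≤ k) ∨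
      (IsPGL 2 (ZMod 7) G ∧ 7 ≤ k) ∨
      (IsPGL 4 (ZMod 2) G ∧ 8 ≤ k) := by
  have hX : Nat.card X = n := by rw [Nat.card_eq_fintype_card, hn]
  constructor
  · intro h
    rcases hG with rfl | ⟨hodd, hA⟩ | ⟨hp, hG⟩ | hG | (hG | hG | hG | hG | hG | hG) |
      (hG | hG | hG) | hG | hG
    · by_cases h4 : n ≤ 4
      · exact Or.inl (Or.inl ⟨rfl, h4⟩)
      · have := card_le_of_alternatingGroup_le (by omega) le_top h
        exact Or.inr (Or.inl ⟨by omega, Or.inl rfl⟩)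
    · rw [hn] at hodd
      by_cases h5 : 5 ≤ n
      · have := card_le_of_alternatingGroup_le (by omega) hA.ge h
        exact Or.inr (Or.inl ⟨by omega, Or.inr (Or.inl ⟨hodd, h5, hA⟩)⟩)
      · obtain rfl | rfl : n = 1 ∨ n = 3 := by
          obtain ⟨m, hm⟩ := hodd
          omega
        · have := Fintype.card_le_one_iff_subsingleton.1 hn.le
          exact Or.inl (Or.inl ⟨Subsingleton.elim _ _, by norm_num⟩)
        · rw [hA]
          exact Or.inl (Or.inr ⟨Nat.prime_three, isBetweenCyclicAndDihedral_alternatingGroup hn⟩)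
    · rw [hn] at hp hG
      exact Or.inl (Or.inr ⟨hp, hG⟩)
    · have h1 := hX.symm.trans hG.card_eq
      have h2 := hG.le_of_isKSolvable h
      exact Or.inr (.inl ⟨by omega, .inr (.inr (.inl ⟨by omega, .inl hG⟩))⟩)
    · have := hG.le_of_isKSolvable_two le_rfl h
      exact .inr (.inr (.inl ⟨hG, this⟩))
    · have := hG.le_of_isKSolvable_two (by norm_num) h
      exact .inr (.inr (.inr (.inr (.inl ⟨hG, this⟩))))
    · have h1 := hX.symm.trans hG.card_eq
      simp only [Nat.card_zmod, Finset.sum_range_succ, Finset.sum_range_zero] at h1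
      have h2 := hG.seven_le_of_isKSolvable h
      exact Or.inr (.inl ⟨by omega, .inr (.inr (.inr (.inr (.inl ⟨by omega, hG⟩))))⟩)
    · have h1 := hX.symm.trans hG.card_eq
      simp only [Nat.card_zmod, Finset.sum_range_succ, Finset.sum_range_zero] at h1
      have h2 := hG.thirteen_le_of_isKSolvable h
      exact Or.inr (.inl ⟨by omega, .inr (.inr (.inr (.inr (.inr (.inl ⟨by omega, hG⟩)))))⟩)
    · have := hG.eight_le_of_isKSolvable h
      exact .inr (.inr (.inr (.inr (.inr (⟨hG, this⟩)))))
    · have h1 := hX.symm.trans hG.card_eq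
      simp only [Nat.card_zmod, Finset.sum_range_succ, Finset.sum_range_zero] at h1
      have h2 := hG.thirtyOne_le_of_isKSolvable h
      exact Or.inr (.inl ⟨by omega,
        .inr (.inr (.inr (.inr (.inr (.inr (.inl ⟨by omega, hG⟩))))))⟩)
    · have h1 := hX.symm.trans hG.card_eq
      simp only [GaloisField.card 2 3 (by norm_num), Finset.sum_range_succ,
        Finset.sum_range_zero] at h1
      have h2 := hG.nine_le_of_isKSolvable h
      exact Or.inr (.inl ⟨by omega,
        .inr (.inr (.inr (.inr (.inr (.inr (.inr (.inr ⟨by omega, hG⟩)))))))⟩)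
    · have := hG.six_le_of_isKSolvable h
      exact .inr (.inr (.inr (.inl ⟨hG, this⟩)))
    · have h1 := hX.symm.trans hG.card_eq
      simp only [GaloisField.card 2 2 (by norm_num), Finset.sum_range_succ,
        Finset.sum_range_zero] at h1
      have h2 := hG.twentyOne_le_of_isKSolvable h
      exact Or.inr (.inl ⟨by omega,
        .inr (.inr (.inr (.inr (.inr (.inr (.inr (.inl ⟨by omega, hG⟩)))))))⟩)
    · have h1 := hX.symm.trans hG.card_eq
      rw [Nat.card_fin] at h1
      have h2 := hG.eleven_le_of_isKSolvable h
      exact Or.inr (.inl ⟨by omega, .inr (.inr (.inl ⟨by omega, .inr hG⟩))⟩)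
    · have h1 := hX.symm.trans hG.card_eq
      rw [Nat.card_fin] at h1
      have h2 := hG.twentyThree_le_of_isKSolvable h
      exact Or.inr (.inl ⟨by omega, .inr (.inr (.inr (.inl ⟨by omega, hG⟩)))⟩)
  · rintro ((⟨rfl, h4⟩ | ⟨-, hG⟩) | ⟨hk, -⟩ | ⟨hG, hk⟩ | ⟨hG, hk⟩ | ⟨hG, hk⟩ | ⟨hG, hk⟩)
    · have := isSolvable_perm (hn.trans_le h4)
      exact isKSolvable_of_isSolvable k _
    · have := isSolvable_of_isBetweenCyclicAndDihedral hG
      exact isKSolvable_of_isSolvable k _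
    · exact isKSolvable_of_card_le (hn.trans_le hk) G
    · exact hG.isKSolvable_two_five hk
    · exact hG.isKSolvable_two_nine hk
    · exact hG.isKSolvable_two_seven hk
    · exact hG.isKSolvable_four_two hk
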